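/- All manifolds and Lie groups are real, smooth, finite-dimensional and without boundary. **Conventions.** A crossed module of Lie groups $G\xrightarrow{\rho}H$ consists of Lie groups $G,H$, a smooth homomorphism $\rho:G\to H$ and a smooth left action $(h,g)\mapsto h(g)$ of $H$ on $G$ by group automorphisms (equivalently, a homomorphism $\jmath:H\to\mathrm{Aut}(G)$ with $(h,g)\mapsto\jmath(h)(g)$ smooth) such that $\rho(h(g))=h\rho(g)h^{-1}$ and $\rho(g)(g')=gg'g^{-1}$. In a Lie groupoid with source $s$, target $t$ and unit map $\epsilon$, the product $xy$ is defined when $t(x)=s(y)$. For a Lie groupoid $\mathcal G\rightrightarrows M$, a *$G\to H$-extension* of $\mathcal G$ is a triple $(\mathcal R\xrightarrow{\varphi}\mathcal G,\;P\xrightarrow{\pi}M,\;\chi)$ where: * $\mathcal R\rightrightarrows M$ is a Lie groupoid and $\varphi$ is a groupoid morphism over $\mathrm{id}_M$ that is a surjective submersion, whose kernel $K=\varphi^{-1}(\epsilon(M))$ is, locally over $M$, isomorphic as a smooth bundle of groups to the trivial bundle with fibre $G$; * $P\to M$ is a smooth right principal $H$-bundle with a smooth left action $(r,p)\mapsto r\bullet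 p$ (defined for $t(r)=\pi(p)$, with $\pi(r\bullet p)=s(r)$) of $\mathcal R$ that commutes with the action of $H$; * $\chi$ assigns to each $p\in P$ a Lie group isomorphism $\chi(p):G\to K_{\pi(p)}$, smoothly in the sense that $(p,g)\mapsto\chi(p)(g)\in\mathcal R$ is smooth, with $$\chi\big((r\bullet p)\cdot h\big)(g)=r\,\chi(p)(h(g))\,r^{-1}\qquad\text{and}\qquad p\cdot\rho(g)=\chi(p)(g)\bullet p$$ for all $p\in P$, $g\in G$, $h\in H$ and $r\in\mathcal R$ with $t(r)=\pi(p)$. An *isomorphism* from $(\mathcal R,P,\chi)$ to $(\mathcal R',P',\chi')$ is a pair $(\Phi,\Psi)$ where $\Phi:\mathcal R\to\mathcal R'$ is an isomorphism of Lie groupoids with $\varphi'\circ\Phi=\varphi$ and $\Psi:P\to P'$ is a diffeomorphism with $\pi'\circ\Psi=\pi$, $\Psi((r\bullet p)\cdot h)=(\Phi(r)\bullet\Psi(p))\cdot h$ and $\chi'(\Psi(p))(g)=\Phi(\chi(p)(g))$. Let $\mathcal U=(U_i)_{i\in I}$ be an open cover of a Hausdorff second countable manifold $N$, and let $U_{ij}=U_i\cap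 U_j$. Write $x_i$ (resp. $x_{ij}$) for a point $x\in U_i$ (resp. $x\in U_{ij}$) regarded as a point of $\coprod_i U_i$ (resp. $\coprod_{i,j}U_{ij}$). The Čech groupoid $N[\mathcal U]$ is $\coprod_{i,j\in I}U_{ij}\rightrightarrows\coprod_{i\in I}U_i$, with $s(x_{ij})=x_i$, $t(x_{ij})=x_j$ and $x_{ij}x_{jk}=x_{ik}$. A $G\to H$-extension of $N[\mathcal U]$ is *adapted* if $\mathcal R=G\times\coprod_{i,j}U_{ij}$ as a manifold, with $\varphi$ the second projection; $P=\coprod_iU_i\times H$, with $\pi$ the first projection and $(x_i,h)\cdot h'=(x_i,hh')$; $\chi(x_i,h)(g)=(h(g),x_{ii})$; and $(g,x_{ii})(g',x_{ij})=(gg',x_{ij})$ in $\mathcal R$, for all $i,j\in I$, all $x$ in $U_i$ (resp. $U_{ij}$), all $g,g'\in G$ and all $h,h'\in H$. **Proposition.** Let $\mathcal U=(U_i)_{i\in I}$ be an open cover of a Hausdorff second countable manifold $N$ such that, for all $i,j\in I$, the open set $U_{ij}$ is empty or contractible, and let $G\to H$ be a crossed module of Lie groups. Then every $G\to H$-extension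 of the Čech groupoid $N[\mathcal U]$ is isomorphic, as a $G\to H$-extension of $N[\mathcal U]$, to an adapted one. -/

import Mathlib

open Set Function TopologicalSpace Topology
open scoped Manifold ContDiff

noncomputable section

/-! ### Disjoint unions of manifolds -/

section Sigma

/-- The disjoint union of a family of charted spaces: a chart is a chart of one of the pieces. -/
instance sigmaChartedSpace {κ H : Type*} [TopologicalSpace H] [Nonempty H] (X : κ → Type*)
    [∀ k, TopologicalSpace (X k)] [∀ k, ChartedSpace H (X k)] : ChartedSpace H (Σ k, X k) where
  atlas := ⋃ k, (fun e ↦ e.lift_openEmbedding (IsOpenEmbedding.sigmaMk (i := k))) '' atlas H (X k)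
  chartAt p := (chartAt H p.2).lift_openEmbedding (IsOpenEmbedding.sigmaMk (i := p.1))
  mem_chart_source p := ⟨p.2, mem_chart_source H p.2, rfl⟩
  chart_mem_atlas p := mem_iUnion.2 ⟨p.1, _, chart_mem_atlas H p.2, rfl⟩

/-- The disjoint union of a family of smooth manifolds is a smooth manifold. -/
instance sigmaIsManifold {κ E H : Type*} [NormedAddCommGroup E] [NormedSpace ℝ E]
    [TopologicalSpace H] [Nonempty H] (I : ModelWithCorners ℝ E H) (X : κ → Type*)
    [∀ k, TopologicalSpace (X k)] [∀ k, ChartedSpace H (X k)] [hX : ∀ k, IsManifold I ∞ (X k)] :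
    IsManifold I ∞ (Σ k, X k) where
  compatible {e} e' he he' := by
    obtain ⟨k, f, hf, rfl⟩ := mem_iUnion.1 he
    obtain ⟨k', f', hf', rfl⟩ := mem_iUnion.1 he'
    by_cases hk : k = k'
    · subst hk
      dsimp only
      rw [f.lift_openEmbedding_trans f' IsOpenEmbedding.sigmaMk]
      exact (hX k).compatible hf hf'
    · apply ContDiffGroupoid.mem_of_source_eq_empty
      rw [eq_empty_iff_forall_notMem]
      rintro x ⟨-, hx⟩
      obtain ⟨y, -, hy⟩ := hx
      exact hk (congrArg Sigma.fst hy).symm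

/-- The chart of a disjoint union of open subsets of `N` around `p`, at a point of the same piece,
is the chart of `N`. -/
theorem sigmaOpens_extChartAt {κ E H N : Type*} [NormedAddCommGroup E] [NormedSpace ℝ E]
    [TopologicalSpace H] [Nonempty H] (I : ModelWithCorners ℝ E H) [TopologicalSpace N]
    [ChartedSpace H N] (V : κ → Opens N) (p q : Σ k, V k) (h : q.1 = p.1) :
    extChartAt I p q = extChartAt I (p.2 : N) (q.2 : N) := by
  obtain ⟨k, x⟩ := p
  obtain ⟨l, y⟩ := q
  obtain rfl : l = k := h
  have : (chartAt H (⟨l, x⟩ : Σ k, V k)) ⟨l, y⟩ = (chartAt H x) y :=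
    OpenPartialHomeomorph.lift_openEmbedding_apply _ _
  simp only [extChartAt, OpenPartialHomeomorph.extend_coe, comp_apply, this]
  rfl

/-- A map to a disjoint union of open subsets of `N` is smooth if the index is locally constant
and the underlying map to `N` is smooth. -/
theorem contMDiffWithinAt_sigmaOpens {κ E H N : Type*} [NormedAddCommGroup E] [NormedSpace ℝ E]
    [TopologicalSpace H] [Nonempty H] {I : ModelWithCorners ℝ E H} [TopologicalSpace N]
    [ChartedSpace H N] {V : κ → Opens N} {E' H' X : Type*} [NormedAddCommGroup E']
    [NormedSpace ℝ E'] [TopologicalSpace H'] {I' : ModelWithCorners ℝ E' H'} [TopologicalSpace X]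
    [ChartedSpace H' X] {f : X → Σ k, V k} {s : Set X} {x : X}
    (h₁ : ∀ᶠ y in 𝓝[s] x, (f y).1 = (f x).1)
    (h₂ : ContMDiffWithinAt I' I ∞ (fun y ↦ ((f y).2 : N)) s x) :
    ContMDiffWithinAt I' I ∞ f s x := by
  rw [contMDiffWithinAt_iff_target] at h₂ ⊢
  refine ⟨?_, h₂.2.congr_of_eventuallyEq ?_ ?_⟩
  · have hc := h₂.1
    unfold ContinuousWithinAt at hc ⊢
    intro W hW
    have h3 : Sigma.mk (f x).1 ⁻¹' W ∈ 𝓝 (f x).2 :=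
      (continuous_sigmaMk (σ := fun k ↦ V k)).continuousAt.preimage_mem_nhds hW
    rw [nhds_subtype, Filter.mem_comap] at h3
    obtain ⟨T, hT, hTW⟩ := h3
    rw [Filter.mem_map]
    filter_upwards [h₁, Filter.mem_map.1 (hc hT)] with y hy hyT
    have key : ∀ (q : Σ k, V k), q.1 = (f x).1 → (q.2 : N) ∈ T → q ∈ W := by
      rintro ⟨k, z⟩ (rfl : k = _) hz
      exact hTW hz
    exact key _ hy hyT
  · filter_upwards [h₁] with y hy
    exact sigmaOpens_extChartAt I V _ _ hy
  · exact sigmaOpens_extChartAt I V _ _ rfl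

theorem sigma_fst_eventually {κ : Type*} {X : κ → Type*} [∀ k, TopologicalSpace (X k)]
    (p : Σ k, X k) : ∀ᶠ q in 𝓝 p, q.1 = p.1 := by
  refine IsOpen.mem_nhds (s := Sigma.fst ⁻¹' {p.1}) ?_ rfl
  rw [isOpen_sigma_iff]
  intro k
  by_cases hk : k = p.1
  · convert isOpen_univ
    ext; simp [hk]
  · convert isOpen_empty
    ext; simp [hk]

/-- The canonical map from a disjoint union of open subsets of `N` to `N` is smooth. -/
theorem contMDiff_sigmaOpens_val {κ E H N : Type*} [NormedAddCommGroup E] [NormedSpace ℝ E]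
    [TopologicalSpace H] [Nonempty H] (I : ModelWithCorners ℝ E H) [TopologicalSpace N]
    [ChartedSpace H N] [IsManifold I ∞ N] (V : κ → Opens N) :
    ContMDiff I I ∞ (fun q : Σ k, V k ↦ (q.2 : N)) := by
  intro p
  have hp := (contMDiffAt_extChartAt (I := I) (n := ∞) (x := p))
  rw [contMDiffAt_iff_target]
  refine ⟨(continuous_sigma fun k ↦ continuous_subtype_val).continuousAt,
    hp.congr_of_eventuallyEq ?_⟩
  filter_upwards [sigma_fst_eventually p] with q hq
  exact (sigmaOpens_extChartAt I V p q hq).symm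

end Sigma

/-! ### Crossed modules of Lie groups -/

section CrossedModule

/-- A crossed module `ρ : G → H` of Lie groups, `H` acting on `G` on the left by automorphisms.
Smoothness of `j : H → Aut(G)` means smoothness of `(h, g) ↦ j h g`. -/
structure LieCrossedModule {EG HG EH HH : Type*} [NormedAddCommGroup EG] [NormedSpace ℝ EG]
    [TopologicalSpace HG] [NormedAddCommGroup EH] [NormedSpace ℝ EH] [TopologicalSpace HH]
    (IG : ModelWithCorners ℝ EG HG) (G : Type*) [TopologicalSpace G] [ChartedSpace HG G] [Group G]
    [LieGroup IG ∞ G]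
    (IH : ModelWithCorners ℝ EH HH) (H : Type*) [TopologicalSpace H] [ChartedSpace HH H] [Group H]
    [LieGroup IH ∞ H] where
  ρ : G →* H
  j : H →* MulAut G
  contMDiff_ρ : ContMDiff IG IH ∞ ρ
  contMDiff_j : ContMDiff (IH.prod IG) IG ∞ (fun q : H × G ↦ j q.1 q.2)
  ρ_j : ∀ (h : H) (g : G), ρ (j h g) = h * ρ g * h⁻¹
  j_ρ : ∀ g g' : G, j (ρ g) g' = g * g' * g⁻¹

end CrossedModule

/-! ### Lie groupoids and their extensions -/

section Groupoid

/-- A Lie groupoid `Γ ⇉ M`. The product `mul a b` is meaningful only for the composable pairs,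
those with `tgt a = src b`; its values elsewhere are irrelevant. The set of composable pairs is an
embedded submanifold of `Γ × Γ`, on which `mul` has to be smooth. -/
structure LieGroupoid {EM HM EΓ HΓ : Type*} [NormedAddCommGroup EM] [NormedSpace ℝ EM]
    [TopologicalSpace HM] [NormedAddCommGroup EΓ] [NormedSpace ℝ EΓ] [TopologicalSpace HΓ]
    (IM : ModelWithCorners ℝ EM HM) (M : Type*) [TopologicalSpace M] [ChartedSpace HM M]
    [IsManifold IM ∞ M]
    (IΓ : ModelWithCorners ℝ EΓ HΓ) (Γ : Type*) [TopologicalSpace Γ] [ChartedSpace HΓ Γ]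
    [IsManifold IΓ ∞ Γ] where
  src : Γ → M
  tgt : Γ → M
  unit : M → Γ
  inv : Γ → Γ
  mul : Γ → Γ → Γ
  src_unit : ∀ m, src (unit m) = m
  tgt_unit : ∀ m, tgt (unit m) = m
  src_inv : ∀ a, src (inv a) = tgt a
  tgt_inv : ∀ a, tgt (inv a) = src a
  src_mul : ∀ a b, tgt a = src b → src (mul a b) = src a
  tgt_mul : ∀ a b, tgt a = src b → tgt (mul a b) = tgt b
  mul_assoc : ∀ a b c, tgt a = src b → tgt b = src c → mul (mul a b) c = mul a (mul b c)
  unit_mul : ∀ a, mul (unit (src a)) a = a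
  mul_unit : ∀ a, mul a (unit (tgt a)) = a
  mul_inv : ∀ a, mul a (inv a) = unit (src a)
  inv_mul : ∀ a, mul (inv a) a = unit (tgt a)
  isSubmersion_src : Manifold.IsSubmersion IΓ IM ∞ src
  isSubmersion_tgt : Manifold.IsSubmersion IΓ IM ∞ tgt
  contMDiff_unit : ContMDiff IM IΓ ∞ unit
  contMDiff_inv : ContMDiff IΓ IΓ ∞ inv
  contMDiffOn_mul : ContMDiffOn (IΓ.prod IΓ) IΓ ∞ (fun q : Γ × Γ ↦ mul q.1 q.2)
    {q | tgt q.1 = src q.2}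

/-- A Lie groupoid extension `φ : R → Γ` of the Lie groupoid `𝒢 = (Γ ⇉ M)`: a Lie groupoid
`R ⇉ M` with a groupoid morphism to `Γ`, over the identity of `M`, that is a surjective
submersion. -/
structure LieGroupoidExtension {EM HM EΓ HΓ ER HR : Type*} [NormedAddCommGroup EM]
    [NormedSpace ℝ EM] [TopologicalSpace HM] [NormedAddCommGroup EΓ] [NormedSpace ℝ EΓ]
    [TopologicalSpace HΓ] [NormedAddCommGroup ER] [NormedSpace ℝ ER] [TopologicalSpace HR]
    {IM : ModelWithCorners ℝ EM HM} {M : Type*} [TopologicalSpace M] [ChartedSpace HM M]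
    [IsManifold IM ∞ M]
    {IΓ : ModelWithCorners ℝ EΓ HΓ} {Γ : Type*} [TopologicalSpace Γ] [ChartedSpace HΓ Γ]
    [IsManifold IΓ ∞ Γ] (𝒢 : LieGroupoid IM M IΓ Γ)
    (IR : ModelWithCorners ℝ ER HR) (R : Type*) [TopologicalSpace R] [ChartedSpace HR R]
    [IsManifold IR ∞ R] extends LieGroupoid IM M IR R where
  φ : R → Γ
  src_φ : ∀ r, 𝒢.src (φ r) = src r
  tgt_φ : ∀ r, 𝒢.tgt (φ r) = tgt r
  φ_mul : ∀ a b, tgt a = src b → φ (mul a b) = 𝒢.mul (φ a) (φ b)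
  φ_unit : ∀ m, φ (unit m) = 𝒢.unit m
  surjective_φ : Surjective φ
  isSubmersion_φ : Manifold.IsSubmersion IR IΓ ∞ φ

namespace LieGroupoidExtension

variable {EM HM EΓ HΓ ER HR EG HG : Type*} [NormedAddCommGroup EM]
  [NormedSpace ℝ EM] [TopologicalSpace HM] [NormedAddCommGroup EΓ] [NormedSpace ℝ EΓ]
  [TopologicalSpace HΓ] [NormedAddCommGroup ER] [NormedSpace ℝ ER] [TopologicalSpace HR]
  [NormedAddCommGroup EG] [NormedSpace ℝ EG] [TopologicalSpace HG]
  {IM : ModelWithCorners ℝ EM HM} {M : Type*} [TopologicalSpace M] [ChartedSpace HM M]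
  [IsManifold IM ∞ M]
  {IΓ : ModelWithCorners ℝ EΓ HΓ} {Γ : Type*} [TopologicalSpace Γ] [ChartedSpace HΓ Γ]
  [IsManifold IΓ ∞ Γ] {𝒢 : LieGroupoid IM M IΓ Γ}
  {IR : ModelWithCorners ℝ ER HR} {R : Type*} [TopologicalSpace R] [ChartedSpace HR R]
  [IsManifold IR ∞ R]

/-- The part `K_V = φ⁻¹(ε(V))` of the kernel `K` lying over `V ⊆ M`. -/
def kernelOver (X : LieGroupoidExtension 𝒢 IR R) (V : Set M) : Set R :=
  {r | ∃ m ∈ V, X.φ r = 𝒢.unit m}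

/-- The extension is a `G`-extension: every point of `M` has an open neighbourhood `V` with a
smooth isomorphism `τ : G × V → K_V` of bundles of groups over `V`. The map `θ` is the
`G`-component of the inverse of `τ`. -/
def IsGroupExtension (X : LieGroupoidExtension 𝒢 IR R) (IG : ModelWithCorners ℝ EG HG) (G : Type*)
    [TopologicalSpace G] [ChartedSpace HG G] [Group G] [LieGroup IG ∞ G] : Prop :=
  ∀ m₀ : M, ∃ V : Set M, IsOpen V ∧ m₀ ∈ V ∧ ∃ (τ : G × M → R) (θ : R → G),
    ContMDiffOn (IG.prod IM) IR ∞ τ (univ ×ˢ V) ∧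
    ContMDiffOn IR IG ∞ θ (X.kernelOver V) ∧
    ∀ m ∈ V,
      (∀ g, X.φ (τ (g, m)) = 𝒢.unit m) ∧
      (∀ g g', τ (g * g', m) = X.mul (τ (g, m)) (τ (g', m))) ∧
      (∀ g, θ (τ (g, m)) = g) ∧
      (∀ r, X.φ r = 𝒢.unit m → τ (θ r, m) = r)

/-- An element of the band: a Lie group isomorphism `G → K_m`, for some `m : M`. -/
structure Band (X : LieGroupoidExtension 𝒢 IR R) (IG : ModelWithCorners ℝ EG HG) (G : Type*)
    [TopologicalSpace G] [ChartedSpace HG G] [Group G] [LieGroup IG ∞ G] where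
  base : M
  toFun : G → R
  φ_toFun : ∀ g, X.φ (toFun g) = 𝒢.unit base
  toFun_mul : ∀ g g', toFun (g * g') = X.mul (toFun g) (toFun g')
  contMDiff_toFun : ContMDiff IG IR ∞ toFun
  exists_inverse : ∃ θ : R → G, ContMDiffOn IR IG ∞ θ (X.kernelOver {base}) ∧
    (∀ g, θ (toFun g) = g) ∧ ∀ r ∈ X.kernelOver {base}, toFun (θ r) = r

end LieGroupoidExtension

end Groupoid

/-! ### Principal bundles over Lie groupoids -/

section PrincipalBundle

/-- A smooth right principal `H`-bundle `P → M`: a smooth right action of `H` on `P` over `M`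
with smooth equivariant local trivialisations. -/
structure LiePrincipalBundle {EM HM EH HH EP HP : Type*} [NormedAddCommGroup EM]
    [NormedSpace ℝ EM] [TopologicalSpace HM] [NormedAddCommGroup EH] [NormedSpace ℝ EH]
    [TopologicalSpace HH] [NormedAddCommGroup EP] [NormedSpace ℝ EP] [TopologicalSpace HP]
    (IM : ModelWithCorners ℝ EM HM) (M : Type*) [TopologicalSpace M] [ChartedSpace HM M]
    [IsManifold IM ∞ M]
    (IH : ModelWithCorners ℝ EH HH) (H : Type*) [TopologicalSpace H] [ChartedSpace HH H] [Group H]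
    [LieGroup IH ∞ H]
    (IP : ModelWithCorners ℝ EP HP) (P : Type*) [TopologicalSpace P] [ChartedSpace HP P]
    [IsManifold IP ∞ P] where
  proj : P → M
  act : P → H → P
  proj_act : ∀ p h, proj (act p h) = proj p
  act_one : ∀ p, act p 1 = p
  act_mul : ∀ p h h', act p (h * h') = act (act p h) h'
  contMDiff_proj : ContMDiff IP IM ∞ proj
  contMDiff_act : ContMDiff (IP.prod IH) IP ∞ (fun q : P × H ↦ act q.1 q.2)
  locally_trivial : ∀ m : M, ∃ e : Bundle.Trivialization H proj, m ∈ e.baseSet ∧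
    ContMDiffOn IP (IM.prod IH) ∞ e e.source ∧
    ContMDiffOn (IM.prod IH) IP ∞ e.toOpenPartialHomeomorph.symm e.target ∧
    ∀ p ∈ e.source, ∀ h, (e (act p h)).2 = (e p).2 * h

/-- A principal `H`-bundle `P → M` over the Lie groupoid `𝒜 = (R ⇉ M)`: a principal `H`-bundle
with a smooth left action `gact` of `R` commuting with the action of `H`. Only the values
`gact r p` with `tgt r = proj p` are meaningful. -/
structure LiePrincipalBundleOver {EM HM ER HR EH HH EP HP : Type*} [NormedAddCommGroup EM]
    [NormedSpace ℝ EM] [TopologicalSpace HM] [NormedAddCommGroup ER] [NormedSpace ℝ ER]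
    [TopologicalSpace HR] [NormedAddCommGroup EH] [NormedSpace ℝ EH]
    [TopologicalSpace HH] [NormedAddCommGroup EP] [NormedSpace ℝ EP] [TopologicalSpace HP]
    {IM : ModelWithCorners ℝ EM HM} {M : Type*} [TopologicalSpace M] [ChartedSpace HM M]
    [IsManifold IM ∞ M]
    {IR : ModelWithCorners ℝ ER HR} {R : Type*} [TopologicalSpace R] [ChartedSpace HR R]
    [IsManifold IR ∞ R] (𝒜 : LieGroupoid IM M IR R)
    (IH : ModelWithCorners ℝ EH HH) (H : Type*) [TopologicalSpace H] [ChartedSpace HH H] [Group H]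
    [LieGroup IH ∞ H]
    (IP : ModelWithCorners ℝ EP HP) (P : Type*) [TopologicalSpace P] [ChartedSpace HP P]
    [IsManifold IP ∞ P] extends LiePrincipalBundle IM M IH H IP P where
  gact : R → P → P
  proj_gact : ∀ r p, 𝒜.tgt r = proj p → proj (gact r p) = 𝒜.src r
  unit_gact : ∀ p, gact (𝒜.unit (proj p)) p = p
  mul_gact : ∀ a b p, 𝒜.tgt a = 𝒜.src b → 𝒜.tgt b = proj p →
    gact (𝒜.mul a b) p = gact a (gact b p)
  gact_act : ∀ r p h, 𝒜.tgt r = proj p → gact r (act p h) = act (gact r p) h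
  contMDiffOn_gact : ContMDiffOn (IR.prod IP) IP ∞ (fun q : R × P ↦ gact q.1 q.2)
    {q | 𝒜.tgt q.1 = proj q.2}

end PrincipalBundle

/-! ### `G → H`-extensions of a Lie groupoid -/

section CrossedModuleExtension

variable {EM HM EΓ HΓ EG HG EH HH ER HR EP HP ER' HR' EP' HP' : Type*}
  [NormedAddCommGroup EM] [NormedSpace ℝ EM] [TopologicalSpace HM]
  [NormedAddCommGroup EΓ] [NormedSpace ℝ EΓ] [TopologicalSpace HΓ]
  [NormedAddCommGroup EG] [NormedSpace ℝ EG] [TopologicalSpace HG]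
  [NormedAddCommGroup EH] [NormedSpace ℝ EH] [TopologicalSpace HH]
  [NormedAddCommGroup ER] [NormedSpace ℝ ER] [TopologicalSpace HR]
  [NormedAddCommGroup EP] [NormedSpace ℝ EP] [TopologicalSpace HP]
  [NormedAddCommGroup ER'] [NormedSpace ℝ ER'] [TopologicalSpace HR']
  [NormedAddCommGroup EP'] [NormedSpace ℝ EP'] [TopologicalSpace HP']
  {IM : ModelWithCorners ℝ EM HM} {M : Type*} [TopologicalSpace M] [ChartedSpace HM M]
  [IsManifold IM ∞ M]
  {IΓ : ModelWithCorners ℝ EΓ HΓ} {Γ : Type*} [TopologicalSpace Γ] [ChartedSpace HΓ Γ]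
  [IsManifold IΓ ∞ Γ]
  {IG : ModelWithCorners ℝ EG HG} {G : Type*} [TopologicalSpace G] [ChartedSpace HG G] [Group G]
  [LieGroup IG ∞ G]
  {IH : ModelWithCorners ℝ EH HH} {H : Type*} [TopologicalSpace H] [ChartedSpace HH H] [Group H]
  [LieGroup IH ∞ H]

/-- A Lie groupoid `G → H`-extension `(R → Γ, P → M, χ)` of the Lie groupoid `𝒢 = (Γ ⇉ M)`:
a `G`-extension `R → Γ`, a principal `H`-bundle `P → M` over `R ⇉ M`, and a smooth map
`χ : P → Band (R → Γ)` over `M` such that `(χ, j)` is equivariant for the actions of `R` and of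
the two structure groups, and such that `p · ρ(g) = χ(p)(g) • p`.

The band carries the left action `r • b = (g ↦ r b(g) r⁻¹)` of `R` and the right action
`b · a = b ∘ a` of `Aut(G)`. Smoothness of a map to the band means joint smoothness in the point
and in `g`. -/
structure CrossedModuleExtension (C : LieCrossedModule IG G IH H) (𝒢 : LieGroupoid IM M IΓ Γ)
    (IR : ModelWithCorners ℝ ER HR) (R : Type*) [TopologicalSpace R] [ChartedSpace HR R]
    [IsManifold IR ∞ R]
    (IP : ModelWithCorners ℝ EP HP) (P : Type*) [TopologicalSpace P] [ChartedSpace HP P]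
    [IsManifold IP ∞ P] where
  ext : LieGroupoidExtension 𝒢 IR R
  isGroupExtension : ext.IsGroupExtension IG G
  bundle : LiePrincipalBundleOver ext.toLieGroupoid IH H IP P
  χ : P → ext.Band IG G
  base_χ : ∀ p, (χ p).base = bundle.proj p
  contMDiff_χ : ContMDiff (IP.prod IG) IR ∞ (fun q : P × G ↦ (χ q.1).toFun q.2)
  χ_equivariant : ∀ r p h g, ext.tgt r = bundle.proj p →
    (χ (bundle.act (bundle.gact r p) h)).toFun g =
      ext.mul (ext.mul r ((χ p).toFun (C.j h g))) (ext.inv r)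
  act_ρ : ∀ p g, bundle.act p (C.ρ g) = bundle.gact ((χ p).toFun g) p

/-- An isomorphism `(Φ, Ψ)` of `G → H`-extensions of the same Lie groupoid `𝒢 = (Γ ⇉ M)`: an
isomorphism `Φ : R → R'` of Lie groupoids, over the identity of `Γ` (hence of `M`), and a
diffeomorphism `Ψ : P → P'` over the identity of `M`, equivariant for the actions of the groupoids
and of `H`, that carries `χ` to `χ'`. -/
structure CrossedModuleExtension.Iso {C : LieCrossedModule IG G IH H} {𝒢 : LieGroupoid IM M IΓ Γ}
    {IR : ModelWithCorners ℝ ER HR} {R : Type*} [TopologicalSpace R] [ChartedSpace HR R]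
    [IsManifold IR ∞ R]
    {IP : ModelWithCorners ℝ EP HP} {P : Type*} [TopologicalSpace P] [ChartedSpace HP P]
    [IsManifold IP ∞ P]
    {IR' : ModelWithCorners ℝ ER' HR'} {R' : Type*} [TopologicalSpace R'] [ChartedSpace HR' R']
    [IsManifold IR' ∞ R']
    {IP' : ModelWithCorners ℝ EP' HP'} {P' : Type*} [TopologicalSpace P'] [ChartedSpace HP' P']
    [IsManifold IP' ∞ P']
    (X : CrossedModuleExtension C 𝒢 IR R IP P) (X' : CrossedModuleExtension C 𝒢 IR' R' IP' P')
    where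
  Φ : Diffeomorph IR IR' R R' ∞
  Ψ : Diffeomorph IP IP' P P' ∞
  φ_Φ : ∀ r, X'.ext.φ (Φ r) = X.ext.φ r
  Φ_mul : ∀ a b, X.ext.tgt a = X.ext.src b → Φ (X.ext.mul a b) = X'.ext.mul (Φ a) (Φ b)
  proj_Ψ : ∀ p, X'.bundle.proj (Ψ p) = X.bundle.proj p
  Ψ_equivariant : ∀ r p h, X.ext.tgt r = X.bundle.proj p →
    Ψ (X.bundle.act (X.bundle.gact r p) h) = X'.bundle.act (X'.bundle.gact (Φ r) (Ψ p)) h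
  χ_Ψ : ∀ p g, (X'.χ (Ψ p)).toFun g = Φ ((X.χ p).toFun g)

end CrossedModuleExtension

/-! ### The Čech groupoid of an open cover and adapted extensions -/

section Cech

variable {EN HN : Type*} [NormedAddCommGroup EN] [NormedSpace ℝ EN] [TopologicalSpace HN]
  [Nonempty HN] (IN : ModelWithCorners ℝ EN HN) {N : Type*} [TopologicalSpace N]
  [ChartedSpace HN N] [IsManifold IN ∞ N] {ι : Type*}

/-- The manifold `∐ i, U i` of objects of the Čech groupoid. -/
abbrev CechObj (U : ι → Opens N) : Type _ := Σ i, U i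

/-- The manifold `∐ i j, U i ∩ U j` of arrows of the Čech groupoid. -/
abbrev CechArr (U : ι → Opens N) : Type _ := Σ p : ι × ι, (U p.1 ⊓ U p.2 : Opens N)

/-- The point `x_i`. -/
def cechObj (U : ι → Opens N) (i : ι) (x : N) (hi : x ∈ U i) : CechObj U := ⟨i, ⟨x, hi⟩⟩

/-- The arrow `x_ij`, from `x_i` to `x_j`. -/
def cechArr (U : ι → Opens N) (i j : ι) (x : N) (hi : x ∈ U i) (hj : x ∈ U j) : CechArr U :=
  ⟨(i, j), ⟨x, hi, hj⟩⟩

/-- A map between disjoint unions of open subsets of `N` that preserves the underlying point of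
`N` and the partition into pieces is a submersion. -/
theorem isSubmersion_sigmaOpens {κ κ' : Type*} {V : κ → Opens N} {W : κ' → Opens N}
    (f : (Σ k, V k) → Σ k, W k) (σ : κ → κ') (hf : ∀ q, (f q).1 = σ q.1)
    (hf' : ∀ q, ((f q).2 : N) = q.2) : Manifold.IsSubmersion IN IN ∞ f := by
  refine Manifold.IsSubmersionOfComplement.isSubmersion (F := PUnit) fun p ↦ ?_
  have hcont : ContinuousAt f p := by
    refine ContMDiffAt.continuousAt (I := IN) (I' := IN) (n := ∞) ?_
    refine contMDiffWithinAt_sigmaOpens ?_ ?_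
    · rw [nhdsWithin_univ]
      filter_upwards [sigma_fst_eventually p] with q hq
      rw [hf, hf, hq]
    · simp only [hf']
      exact contMDiff_sigmaOpens_val IN V p
  refine Manifold.IsSubmersionAtOfComplement.mk_of_continuousAt hcont
    (ContinuousLinearEquiv.prodUnique ℝ EN PUnit).symm (chartAt HN p) (chartAt HN (f p))
    (mem_chart_source _ _) (mem_chart_source _ _) (IsManifold.chart_mem_maximalAtlas _)
    (IsManifold.chart_mem_maximalAtlas _) ?_
  intro z hz
  change extChartAt IN (f p) (f ((extChartAt IN p).symm z)) = z
  have hz' : z ∈ (extChartAt IN p).target := hz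
  have h1 : ((extChartAt IN p).symm z).1 = p.1 := by
    have := (extChartAt IN p).map_target hz'
    rw [extChartAt_source] at this
    obtain ⟨y, -, hy⟩ := this
    rw [← hy]
  rw [sigmaOpens_extChartAt IN W _ _ (by rw [hf, hf, h1]), hf', hf',
    ← sigmaOpens_extChartAt IN V _ _ h1, (extChartAt IN p).right_inv hz']

open Classical in
/-- The product `x_ij • x_jk = x_ik`, extended by a junk value to all pairs of arrows. -/
def cechMul (U : ι → Opens N) (a b : CechArr U) : CechArr U :=
  if h : (a.2 : N) ∈ U b.1.2 then cechArr U a.1.1 b.1.2 a.2 a.2.2.1 h else a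

theorem cechObj_inj {U : ι → Opens N} {i j : ι} {x y : N} {hi : x ∈ U i} {hj : y ∈ U j}
    (h : cechObj U i x hi = cechObj U j y hj) : i = j ∧ x = y := by
  refine ⟨congrArg Sigma.fst h, congrArg (fun q : CechObj U ↦ (q.2 : N)) h⟩

theorem cechMul_mk {U : ι → Opens N} (i j k : ι) (x : N) (hi : x ∈ U i) (hj : x ∈ U j)
    (hk : x ∈ U k) :
    cechMul U (cechArr U i j x hi hj) (cechArr U j k x hj hk) = cechArr U i k x hi hk :=
  dif_pos hk

/-- The Čech groupoid `N[U] = (∐ i j, U i ∩ U j ⇉ ∐ i, U i)`. -/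
def cechGroupoid (U : ι → Opens N) : LieGroupoid IN (CechObj U) IN (CechArr U) where
  src a := cechObj U a.1.1 a.2 a.2.2.1
  tgt a := cechObj U a.1.2 a.2 a.2.2.2
  unit m := cechArr U m.1 m.1 m.2 m.2.2 m.2.2
  inv a := cechArr U a.1.2 a.1.1 a.2 a.2.2.2 a.2.2.1
  mul := cechMul U
  src_unit _ := rfl
  tgt_unit _ := rfl
  src_inv _ := rfl
  tgt_inv _ := rfl
  src_mul := by
    rintro ⟨⟨i, j⟩, x, hi, hj⟩ ⟨⟨j', k⟩, y, hj', hk⟩ h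
    obtain ⟨rfl, rfl⟩ := cechObj_inj h
    have := congrArg (fun a : CechArr U ↦ cechObj U a.1.1 a.2 a.2.2.1)
      (cechMul_mk i j k x hi hj hk)
    exact this
  tgt_mul := by
    rintro ⟨⟨i, j⟩, x, hi, hj⟩ ⟨⟨j', k⟩, y, hj', hk⟩ h
    obtain ⟨rfl, rfl⟩ := cechObj_inj h
    have := congrArg (fun a : CechArr U ↦ cechObj U a.1.2 a.2 a.2.2.2)
      (cechMul_mk i j k x hi hj hk)
    exact this
  mul_assoc := by
    rintro ⟨⟨i, j⟩, x, hi, hj⟩ ⟨⟨j', k⟩, y, hj', hk⟩ ⟨⟨k', l⟩, z, hk', hl⟩ h h'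
    obtain ⟨rfl, rfl⟩ := cechObj_inj h
    obtain ⟨rfl, rfl⟩ := cechObj_inj h'
    have h₁ := cechMul_mk i j k x hi hj hk
    have h₂ := cechMul_mk j k l x hj hk hl
    have h₃ := cechMul_mk i j l x hi hj hl
    have h₄ := cechMul_mk i k l x hi hk hl
    exact ((congrArg (fun a ↦ cechMul U a (cechArr U k l x hk hl)) h₁).trans h₄).trans
      ((congrArg (cechMul U (cechArr U i j x hi hj)) h₂).trans h₃).symm
  unit_mul := fun ⟨⟨i, j⟩, x, hi, hj⟩ ↦ cechMul_mk i i j x hi hi hj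
  mul_unit := fun ⟨⟨i, j⟩, x, hi, hj⟩ ↦ cechMul_mk i j j x hi hj hj
  mul_inv := fun ⟨⟨i, j⟩, x, hi, hj⟩ ↦ cechMul_mk i j i x hi hj hi
  inv_mul := fun ⟨⟨i, j⟩, x, hi, hj⟩ ↦ cechMul_mk j i j x hj hi hj
  isSubmersion_src := isSubmersion_sigmaOpens IN _ Prod.fst (fun _ ↦ rfl) (fun _ ↦ rfl)
  isSubmersion_tgt := isSubmersion_sigmaOpens IN _ Prod.snd (fun _ ↦ rfl) (fun _ ↦ rfl)
  contMDiff_unit := by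
    intro m
    refine contMDiffWithinAt_sigmaOpens ?_ (contMDiff_sigmaOpens_val IN U m)
    rw [nhdsWithin_univ]
    filter_upwards [sigma_fst_eventually m] with q hq
    exact congrArg (fun i : ι ↦ (i, i)) hq
  contMDiff_inv := by
    intro m
    refine contMDiffWithinAt_sigmaOpens ?_ (contMDiff_sigmaOpens_val IN _ m)
    rw [nhdsWithin_univ]
    filter_upwards [sigma_fst_eventually m] with q hq
    exact congrArg Prod.swap hq
  contMDiffOn_mul := by
    have key : ∀ q : CechArr U × CechArr U,
        cechObj U q.1.1.2 q.1.2 q.1.2.2.2 = cechObj U q.2.1.1 q.2.2 q.2.2.2.1 →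
        (cechMul U q.1 q.2).1 = (q.1.1.1, q.2.1.2) := by
      rintro ⟨⟨⟨i, j⟩, x, hi, hj⟩, ⟨⟨j', k⟩, y, hj', hk⟩⟩ h
      have h' : cechObj U j x hj = cechObj U j' y hj' := h
      obtain ⟨rfl, rfl⟩ := cechObj_inj h'
      exact congrArg Sigma.fst (cechMul_mk i j k x hi hj hk)
    have key' : ∀ q : CechArr U × CechArr U, ((cechMul U q.1 q.2).2 : N) = q.1.2 := by
      intro q
      by_cases h : (q.1.2 : N) ∈ U q.2.1.2
      · have e : cechMul U q.1 q.2 = cechArr U q.1.1.1 q.2.1.2 q.1.2 q.1.2.2.1 h := dif_pos h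
        rw [e, cechArr]
      · have e : cechMul U q.1 q.2 = q.1 := dif_neg h
        rw [e]
    intro m hm
    refine contMDiffWithinAt_sigmaOpens ?_ ?_
    · filter_upwards [self_mem_nhdsWithin,
        nhdsWithin_le_nhds (continuous_fst.continuousAt.eventually (sigma_fst_eventually m.1)),
        nhdsWithin_le_nhds (continuous_snd.continuousAt.eventually (sigma_fst_eventually m.2))]
        with q hq h₁ h₂
      have e₁ := key q hq
      have e₂ := key m hm
      rw [e₁, e₂, h₁, h₂]
    · simp only [key']
      exact ((contMDiff_sigmaOpens_val IN _).comp contMDiff_fst m).contMDiffWithinAt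

end Cech

section Adapted

variable {EN HN EG HG EH HH : Type*}
  [NormedAddCommGroup EN] [NormedSpace ℝ EN] [TopologicalSpace HN] [Nonempty HN]
  [NormedAddCommGroup EG] [NormedSpace ℝ EG] [TopologicalSpace HG]
  [NormedAddCommGroup EH] [NormedSpace ℝ EH] [TopologicalSpace HH]
  {IN : ModelWithCorners ℝ EN HN} {N : Type*} [TopologicalSpace N] [ChartedSpace HN N]
  [IsManifold IN ∞ N] {ι : Type*} {U : ι → Opens N}
  {IG : ModelWithCorners ℝ EG HG} {G : Type*} [TopologicalSpace G] [ChartedSpace HG G] [Group G]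
  [LieGroup IG ∞ G]
  {IH : ModelWithCorners ℝ EH HH} {H : Type*} [TopologicalSpace H] [ChartedSpace HH H] [Group H]
  [LieGroup IH ∞ H] {C : LieCrossedModule IG G IH H}

/-- A `G → H`-extension of the Čech groupoid `N[U]` whose manifold of arrows is
`G × ∐ i j, U i ∩ U j` and whose principal bundle is `(∐ i, U i) × H` is adapted if:
`φ` is the second projection; the bundle is the trivial one; `χ (x_i, h) = (g ↦ (h(g), x_ii))`;
and `(g, x_ii) • (g', x_ij) = (g g', x_ij)`. -/
structure CrossedModuleExtension.IsAdapted
    (A : CrossedModuleExtension C (cechGroupoid IN U) (IG.prod IN) (G × CechArr U)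
      (IN.prod IH) (CechObj U × H)) : Prop where
  φ_eq : ∀ (g : G) (a : CechArr U), A.ext.φ (g, a) = a
  proj_eq : ∀ (m : CechObj U) (h : H), A.bundle.proj (m, h) = m
  act_eq : ∀ (m : CechObj U) (h h' : H), A.bundle.act (m, h) h' = (m, h * h')
  χ_eq : ∀ (i : ι) (x : N) (hi : x ∈ U i) (h : H) (g : G),
    (A.χ (cechObj U i x hi, h)).toFun g = (C.j h g, cechArr U i i x hi hi)
  mul_eq : ∀ (i j : ι) (x : N) (hi : x ∈ U i) (hj : x ∈ U j) (g g' : G),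
    A.ext.mul (g, cechArr U i i x hi hi) (g', cechArr U i j x hi hj) =
      (g * g', cechArr U i j x hi hj)

end Adapted

end

/-! The pieces `U i` and `U i ⊓ U j` are contractible, so every bundle in sight is trivial. The
principal bundle `P` has a smooth section `σ`. Through `χ (σ m)` the group `G` is identified with
each fibre of the kernel, and left multiplication by the kernel makes `φ : R → ∐ U_ij` a bundle of
`G`-torsors; it has a smooth section `τ`, which can be normalised to be the unit on every `U_ii`.
The maps `(x_i, h) ↦ σ(x_i) · h` and `(g, x_ij) ↦ χ(σ(x_i))(g) τ(x_ij)` are then diffeomorphisms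
onto `P` and `R`. Transporting the whole structure along their inverses gives an extension
isomorphic to the given one, and it is adapted: the formula for `χ` is its `H`-equivariance, and the
product formula is associativity together with multiplicativity of `χ(σ(x_i))`.

Two analytic facts carry this. The first is that a torsor with smooth local sections over a
contractible manifold has a smooth section (`IsSmoothTorsor.exists_contMDiff_section`). A continuous
section comes from lifting a contraction of the base, one member of a partition of unity at a time.
It is then made smooth by successive local perturbations in charts of the structure group; local
finiteness makes both infinite processes stabilise near each point. `IsSmoothTorsor` keeps only the
action map and the division map, so it covers both `P` and `R`.

The second is that the fibrewise inverses of the smooth family `χ (σ m)` again form a smooth family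
(`contMDiffAt_parametrized_inverse`), by the implicit function theorem. This gives the smooth
division map on `R`. -/

noncomputable section

/-! ### Inverting smooth families of bijections -/

section ParametrizedInverse

variable {EM : Type*} [NormedAddCommGroup EM] [NormedSpace ℝ EM] [FiniteDimensional ℝ EM]
  {EG : Type*} [NormedAddCommGroup EG] [NormedSpace ℝ EG] [FiniteDimensional ℝ EG]

/-- The inverses of a smooth family of invertible maps between vector spaces form a smooth family,
provided that the derivative in the direction of the fibre is invertible: local version. -/
theorem ContDiffAt.exists_parametrized_inverse {α : EM × EG → EG} {a₀ : EM} {v₀ : EG}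
    {β : EG → EG} (hα : ContDiffAt ℝ ∞ α (a₀, v₀)) (hβ : ContDiffAt ℝ ∞ β (α (a₀, v₀)))
    (hαβ : ∀ᶠ y in 𝓝 (α (a₀, v₀)), α (a₀, β y) = y) (hβα : ∀ᶠ v in 𝓝 v₀, β (α (a₀, v)) = v) :
    ∃ ψ : EM × EG → EG, ContDiffAt ℝ ∞ ψ (a₀, α (a₀, v₀)) ∧ ψ (a₀, α (a₀, v₀)) = v₀ ∧
      ∀ᶠ q in 𝓝 (a₀, α (a₀, v₀)), α (q.1, ψ q) = q.2 := by
  have : CompleteSpace EM := FiniteDimensional.complete ℝ EM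
  have : CompleteSpace EG := FiniteDimensional.complete ℝ EG
  set y₀ := α (a₀, v₀) with hy₀
  -- The family of inverses solves `f ((a, y), v) = 0` for `v`, so it is the implicit function of
  -- `f` with parameters `(a, y)`.
  let f : (EM × EG) × EG → EG := fun q ↦ α (q.1.1, q.2) - q.1.2
  have hf : ContDiffAt ℝ ∞ f ((a₀, y₀), v₀) := by
    refine ContDiffAt.sub ?_ (by fun_prop)
    exact ContDiffAt.comp (f := fun q : (EM × EG) × EG ↦ (q.1.1, q.2)) _ hα (by fun_prop)
  have hn : (∞ : WithTop ℕ∞) ≠ 0 := by simp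
  have hα' : HasFDerivAt α (fderiv ℝ α (a₀, v₀)) (a₀, v₀) := (hα.differentiableAt hn).hasFDerivAt
  have hβ' : HasFDerivAt β (fderiv ℝ β y₀) y₀ := (hβ.differentiableAt hn).hasFDerivAt
  have hβy : β y₀ = v₀ := hβα.self_of_nhds
  have hinr : HasFDerivAt (fun v : EG ↦ (a₀, v)) (.inr ℝ EM EG) v₀ := hasFDerivAt_prodMk_right a₀ v₀
  have hA : HasFDerivAt (fun v ↦ α (a₀, v)) (fderiv ℝ α (a₀, v₀) ∘L .inr ℝ EM EG) v₀ :=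
    hα'.comp v₀ hinr
  set A := fderiv ℝ α (a₀, v₀) ∘L .inr ℝ EM EG with hAdef
  -- Differentiating the two inverse relations over `a₀` alone shows that the fibre derivative `A`
  -- is invertible, with inverse the derivative of `β`.
  have h1 : A ∘L fderiv ℝ β y₀ = .id ℝ EG := by
    have h := HasFDerivAt.comp (g := fun v ↦ α (a₀, v)) y₀ (by rw [hβy]; exact hA) hβ'
    exact h.unique ((hasFDerivAt_id y₀).congr_of_eventuallyEq hαβ)
  have h2 : fderiv ℝ β y₀ ∘L A = .id ℝ EG := by
    have h := HasFDerivAt.comp (g := β) v₀ hβ' hA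
    exact h.unique ((hasFDerivAt_id v₀).congr_of_eventuallyEq hβα)
  have hfA : fderiv ℝ f ((a₀, y₀), v₀) ∘L .inr ℝ (EM × EG) EG = A := by
    have h3 : HasFDerivAt f (fderiv ℝ f ((a₀, y₀), v₀)) ((a₀, y₀), v₀) :=
      (hf.differentiableAt hn).hasFDerivAt
    have h4 := HasFDerivAt.comp v₀ h3 (hasFDerivAt_prodMk_right (𝕜 := ℝ) (a₀, y₀) v₀)
    have h5 : HasFDerivAt (fun v ↦ α (a₀, v) - y₀) A v₀ := hA.sub_const y₀
    exact h4.unique h5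
  have hinv : (fderiv ℝ f ((a₀, y₀), v₀) ∘L .inr ℝ (EM × EG) EG).IsInvertible := by
    rw [hfA]
    refine ⟨ContinuousLinearEquiv.equivOfInverse A (fderiv ℝ β y₀) ?_ ?_, rfl⟩
    · intro v; exact congrArg (fun L : EG →L[ℝ] EG ↦ L v) h2
    · intro v; exact congrArg (fun L : EG →L[ℝ] EG ↦ L v) h1
  refine ⟨hf.implicitFunction hn hinv, hf.contDiffAt_implicitFunction hn hinv,
    hf.implicitFunction_apply_self hn hinv, ?_⟩
  filter_upwards [hf.eventually_apply_implicitFunction hn hinv] with q hq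
  have : f ((a₀, y₀), v₀) = 0 := sub_self _
  rw [this] at hq
  exact sub_eq_zero.1 hq

variable {M : Type*} [TopologicalSpace M] [ChartedSpace EM M] [IsManifold 𝓘(ℝ, EM) ∞ M]
  {G : Type*} [TopologicalSpace G] [ChartedSpace EG G] [IsManifold 𝓘(ℝ, EG) ∞ G]
  {G' : Type*} [TopologicalSpace G'] [ChartedSpace EG G'] [IsManifold 𝓘(ℝ, EG) ∞ G']

/-- If `α m : G → G'`, `m ∈ M`, is a smooth family of bijections, and the inverse of `α m₀` is
smooth, then the family of the inverses `β m` is smooth over `m₀`. -/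
theorem contMDiffAt_parametrized_inverse {α : M × G → G'} {β : M × G' → G} {m₀ : M} {y₀ : G'}
    (hα : ContMDiffAt (𝓘(ℝ, EM).prod 𝓘(ℝ, EG)) 𝓘(ℝ, EG) ∞ α (m₀, β (m₀, y₀)))
    (hβ : ContMDiffAt 𝓘(ℝ, EG) 𝓘(ℝ, EG) ∞ (fun y ↦ β (m₀, y)) y₀)
    (hαβ : ∀ y, α (m₀, β (m₀, y)) = y) (hβα : ∀ᶠ m in 𝓝 m₀, ∀ g, β (m, α (m, g)) = g) :
    ContMDiffAt (𝓘(ℝ, EM).prod 𝓘(ℝ, EG)) 𝓘(ℝ, EG) ∞ β (m₀, y₀) := by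
  set g₀ := β (m₀, y₀) with hg₀
  let cm := extChartAt 𝓘(ℝ, EM) m₀
  let cg := extChartAt 𝓘(ℝ, EG) g₀
  let cy := extChartAt 𝓘(ℝ, EG) y₀
  have hαg : α (m₀, g₀) = y₀ := hαβ y₀
  have hcm : ContMDiffAt 𝓘(ℝ, EM) 𝓘(ℝ, EM) ∞ cm.symm (cm m₀) :=
    contMDiffOn_extChartAt_symm m₀ |>.contMDiffAt (extChartAt_target_mem_nhds m₀)
  have hcg : ContMDiffAt 𝓘(ℝ, EG) 𝓘(ℝ, EG) ∞ cg.symm (cg g₀) :=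
    contMDiffOn_extChartAt_symm g₀ |>.contMDiffAt (extChartAt_target_mem_nhds g₀)
  have hcy : ContMDiffAt 𝓘(ℝ, EG) 𝓘(ℝ, EG) ∞ cy.symm (cy y₀) :=
    contMDiffOn_extChartAt_symm y₀ |>.contMDiffAt (extChartAt_target_mem_nhds y₀)
  have ecm : cm.symm (cm m₀) = m₀ := extChartAt_to_inv m₀
  have ecg : cg.symm (cg g₀) = g₀ := extChartAt_to_inv g₀
  have ecy : cy.symm (cy y₀) = y₀ := extChartAt_to_inv y₀
  let a : EM × EG → EG := fun q ↦ cy (α (cm.symm q.1, cg.symm q.2))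
  let b : EG → EG := fun y ↦ cg (β (m₀, cy.symm y))
  have ha₀ : a (cm m₀, cg g₀) = cy y₀ := by simp only [a, ecm, ecg, hαg]
  have ha' : ContMDiffAt 𝓘(ℝ, EM × EG) 𝓘(ℝ, EG) ∞
      (fun q : EM × EG ↦ α (cm.symm q.1, cg.symm q.2)) (cm m₀, cg g₀) := by
    refine ContMDiffAt.comp (g := α) (cm m₀, cg g₀) (by rw [ecm, ecg]; exact hα) ?_
    refine ContMDiffAt.prodMk ?_ ?_
    · exact ContMDiffAt.comp (g := cm.symm) (cm m₀, cg g₀) hcm contDiff_fst.contMDiff.contMDiffAt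
    · exact ContMDiffAt.comp (g := cg.symm) (cm m₀, cg g₀) hcg contDiff_snd.contMDiff.contMDiffAt
  have ha : ContDiffAt ℝ ∞ a (cm m₀, cg g₀) := by
    rw [← contMDiffAt_iff_contDiffAt]
    refine ContMDiffAt.comp (g := cy) (cm m₀, cg g₀) ?_ ha'
    simp only [ecm, ecg, hαg]
    exact contMDiffAt_extChartAt
  have hb' : ContMDiffAt 𝓘(ℝ, EG) 𝓘(ℝ, EG) ∞ (fun y ↦ β (m₀, cy.symm y)) (cy y₀) :=
    ContMDiffAt.comp (g := fun y ↦ β (m₀, y)) (cy y₀) (by rw [ecy]; exact hβ) hcy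
  have hb : ContDiffAt ℝ ∞ b (cy y₀) := by
    rw [← contMDiffAt_iff_contDiffAt]
    refine ContMDiffAt.comp (g := cg) (cy y₀) ?_ hb'
    simp only [ecy]
    exact contMDiffAt_extChartAt
  have hab : ∀ᶠ y in 𝓝 (cy y₀), a (cm m₀, b y) = y := by
    have h1 : ∀ᶠ y in 𝓝 (cy y₀), β (m₀, cy.symm y) ∈ cg.source := by
      refine hb'.continuousAt.eventually_mem ?_
      simp only [ecy]
      exact extChartAt_source_mem_nhds g₀
    filter_upwards [h1, extChartAt_target_mem_nhds (I := 𝓘(ℝ, EG)) y₀] with y hy hy'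
    simp only [a, b]
    rw [ecm, cg.left_inv hy, hαβ, cy.right_inv hy']
  have hba : ∀ᶠ v in 𝓝 (cg g₀), b (a (cm m₀, v)) = v := by
    have h1 : ∀ᶠ q in 𝓝 (cm m₀, cg g₀), α (cm.symm q.1, cg.symm q.2) ∈ cy.source := by
      refine ha'.continuousAt.eventually_mem ?_
      simp only [ecm, ecg, hαg]
      exact extChartAt_source_mem_nhds y₀
    have h2 : Filter.Tendsto (fun v ↦ (cm m₀, v)) (𝓝 (cg g₀)) (𝓝 (cm m₀, cg g₀)) :=
      (Continuous.prodMk_right (cm m₀)).tendsto _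
    filter_upwards [h2.eventually h1, extChartAt_target_mem_nhds (I := 𝓘(ℝ, EG)) g₀] with v hv hv'
    simp only [a, b]
    rw [cy.left_inv hv, ecm, hβα.self_of_nhds, cg.right_inv hv']
  obtain ⟨ψ, hψ, hψ₀, hψa⟩ := ha.exists_parametrized_inverse (by rw [ha₀]; exact hb)
    (by rw [ha₀]; exact hab) hba
  rw [ha₀] at hψ hψ₀ hψa
  have hcc : ContMDiffAt (𝓘(ℝ, EM).prod 𝓘(ℝ, EG)) 𝓘(ℝ, EM × EG) ∞
      (fun q : M × G' ↦ (cm q.1, cy q.2)) (m₀, y₀) := by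
    refine ContMDiffAt.prodMk_space ?_ ?_
    · exact ContMDiffAt.comp (g := cm) (m₀, y₀) contMDiffAt_extChartAt contMDiffAt_fst
    · exact ContMDiffAt.comp (g := cy) (m₀, y₀) contMDiffAt_extChartAt contMDiffAt_snd
  have hψc : ContMDiffAt (𝓘(ℝ, EM).prod 𝓘(ℝ, EG)) 𝓘(ℝ, EG) ∞
      (fun q : M × G' ↦ ψ (cm q.1, cy q.2)) (m₀, y₀) :=
    ContMDiffAt.comp (g := ψ) (m₀, y₀) hψ.contMDiffAt hcc
  have hcand : ContMDiffAt (𝓘(ℝ, EM).prod 𝓘(ℝ, EG)) 𝓘(ℝ, EG) ∞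
      (fun q : M × G' ↦ cg.symm (ψ (cm q.1, cy q.2))) (m₀, y₀) :=
    ContMDiffAt.comp (g := cg.symm) (m₀, y₀) (by rw [hψ₀]; exact hcg) hψc
  -- The implicit function yields some `g` near `g₀` with `α (m, g) = y`. Applying the left inverse
  -- `β (m, ·)` forces `g = β (m, y)`, so the smooth candidate is `β` itself.
  refine hcand.congr_of_eventuallyEq ?_
  have e1 : ∀ᶠ q in 𝓝 (m₀, y₀), a (cm q.1, ψ (cm q.1, cy q.2)) = cy q.2 :=
    hcc.continuousAt.eventually hψa
  have e2 : ∀ᶠ q in 𝓝 (m₀, y₀),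
      α (cm.symm (cm q.1), cg.symm (ψ (cm q.1, cy q.2))) ∈ cy.source := by
    have h1 : ContinuousAt (fun q : M × G' ↦ (cm q.1, ψ (cm q.1, cy q.2))) (m₀, y₀) :=
      (hcc.continuousAt.fst).prodMk hψc.continuousAt
    have h2 : ContinuousAt (fun q : M × G' ↦
        α (cm.symm (cm q.1), cg.symm (ψ (cm q.1, cy q.2)))) (m₀, y₀) :=
      ContinuousAt.comp (g := fun q : EM × EG ↦ α (cm.symm q.1, cg.symm q.2))
        (f := fun q : M × G' ↦ (cm q.1, ψ (cm q.1, cy q.2)))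
        (by simp only [hψ₀]; exact ha'.continuousAt) h1
    refine h2.eventually_mem ?_
    simp only [ecm, hψ₀, ecg, hαg]
    exact extChartAt_source_mem_nhds y₀
  have e3 : ∀ᶠ q in 𝓝 (m₀, y₀), q.1 ∈ cm.source :=
    continuousAt_fst.eventually_mem (extChartAt_source_mem_nhds m₀)
  have e4 : ∀ᶠ q in 𝓝 (m₀, y₀), q.2 ∈ cy.source :=
    continuousAt_snd.eventually_mem (extChartAt_source_mem_nhds y₀)
  filter_upwards [e1, e2, e3, e4, continuousAt_fst.eventually hβα] with q h1 h2 h3 h4 h5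
  rw [cm.left_inv h3] at h2
  simp only [a] at h1
  rw [cm.left_inv h3] at h1
  have h6 := cy.injOn h2 h4 h1
  have h7 := h5 (cg.symm (ψ (cm q.1, cy q.2)))
  rw [h6] at h7
  exact h7

end ParametrizedInverse

/-! ### Continuous sections of torsors by homotopy lifting -/

section Torsor

/-- Smooth torsor data for `H` along `π : P → M`: a smooth map `act : P × H → P` over `M` and a
smooth division map, defined on the pairs of points with the same projection. -/
structure IsSmoothTorsor {EH HH EP HP : Type*} [NormedAddCommGroup EH] [NormedSpace ℝ EH]
    [TopologicalSpace HH] [NormedAddCommGroup EP] [NormedSpace ℝ EP] [TopologicalSpace HP]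
    (IH : ModelWithCorners ℝ EH HH) {H : Type*} [TopologicalSpace H] [ChartedSpace HH H]
    (IP : ModelWithCorners ℝ EP HP) {P : Type*} [TopologicalSpace P] [ChartedSpace HP P]
    {M : Type*} (π : P → M) (act : P → H → P) (div : P → P → H) : Prop where
  contMDiff_act : ContMDiff (IP.prod IH) IP ∞ (fun q : P × H ↦ act q.1 q.2)
  contMDiffOn_div : ContMDiffOn (IP.prod IP) IH ∞ (fun q : P × P ↦ div q.1 q.2)
    {q | π q.1 = π q.2}
  proj_act : ∀ p h, π (act p h) = π p
  act_div : ∀ p q, π p = π q → act p (div p q) = q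

variable {EH HH EP HP : Type*} [NormedAddCommGroup EH] [NormedSpace ℝ EH]
  [TopologicalSpace HH] [NormedAddCommGroup EP] [NormedSpace ℝ EP] [TopologicalSpace HP]
  {IH : ModelWithCorners ℝ EH HH} {H : Type*} [TopologicalSpace H] [ChartedSpace HH H]
  {IP : ModelWithCorners ℝ EP HP} {P : Type*} [TopologicalSpace P] [ChartedSpace HP P]
  {M : Type*} {π : P → M} {act : P → H → P} {div : P → P → H}
  {B : Type*} [TopologicalSpace B]

theorem IsSmoothTorsor.continuous_act (T : IsSmoothTorsor IH IP π act div) :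
    Continuous (fun q : P × H ↦ act q.1 q.2) := T.contMDiff_act.continuous

theorem IsSmoothTorsor.continuousOn_div_comp (T : IsSmoothTorsor IH IP π act div) {X : Type*}
    [TopologicalSpace X] {S : Set X} {f g : X → P} (hf : ContinuousOn f S) (hg : ContinuousOn g S)
    (h : ∀ x ∈ S, π (f x) = π (g x)) : ContinuousOn (fun x ↦ div (f x) (g x)) S :=
  T.contMDiffOn_div.continuousOn.comp (hf.prodMk hg) h

theorem IsSmoothTorsor.continuousOn_act_comp (T : IsSmoothTorsor IH IP π act div) {X : Type*}
    [TopologicalSpace X] {S : Set X} {f : X → P} {g : X → H} (hf : ContinuousOn f S)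
    (hg : ContinuousOn g S) : ContinuousOn (fun x ↦ act (f x) (g x)) S :=
  T.continuous_act.comp_continuousOn (hf.prodMk hg)

/-- Two lifts of a homotopy over adjacent time intervals can be joined, by translating the second
one. -/
theorem IsSmoothTorsor.exists_lift_union (T : IsSmoothTorsor IH IP π act div) {F : B × ℝ → M}
    {W : Set B} {a c d : ℝ} (hac : a ≤ c) (hcd : c ≤ d) {θ₁ θ₂ : B × ℝ → P}
    (h₁ : ContinuousOn θ₁ (W ×ˢ Icc a c)) (h₁' : ∀ q ∈ W ×ˢ Icc a c, π (θ₁ q) = F q)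
    (h₂ : ContinuousOn θ₂ (W ×ˢ Icc c d)) (h₂' : ∀ q ∈ W ×ˢ Icc c d, π (θ₂ q) = F q) :
    ∃ θ : B × ℝ → P, ContinuousOn θ (W ×ˢ Icc a d) ∧ ∀ q ∈ W ×ˢ Icc a d, π (θ q) = F q := by
  have hc₁ : ∀ q ∈ W ×ˢ Icc c d, (q.1, c) ∈ W ×ˢ Icc a c := fun q hq ↦ ⟨hq.1, hac, le_rfl⟩
  have hc₂ : ∀ q ∈ W ×ˢ Icc c d, (q.1, c) ∈ W ×ˢ Icc c d := fun q hq ↦ ⟨hq.1, le_rfl, hcd⟩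
  have heq : ∀ q ∈ W ×ˢ Icc c d, π (θ₂ (q.1, c)) = π (θ₁ (q.1, c)) := fun q hq ↦
    (h₂' _ (hc₂ q hq)).trans (h₁' _ (hc₁ q hq)).symm
  have hcont : Continuous (fun q : B × ℝ ↦ (q.1, c)) := by fun_prop
  -- The translating element is read off at time `c` and does not depend on the time coordinate of
  -- `q`; at time `c` the translated lift equals `θ₁`, so the two pieces glue.
  have hg : ContinuousOn (fun q ↦ act (θ₂ q) (div (θ₂ (q.1, c)) (θ₁ (q.1, c)))) (W ×ˢ Icc c d) :=
    T.continuousOn_act_comp h₂ (T.continuousOn_div_comp (h₂.comp hcont.continuousOn hc₂)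
      (h₁.comp hcont.continuousOn hc₁) heq)
  refine ⟨fun q ↦ if q.2 ≤ c then θ₁ q else act (θ₂ q) (div (θ₂ (q.1, c)) (θ₁ (q.1, c))),
    ContinuousOn.if ?_ ?_ ?_, ?_⟩
  · rintro ⟨x, t⟩ ⟨hq, hf⟩
    have ht : t = c := frontier_le_subset_eq continuous_snd continuous_const hf
    subst ht
    exact (T.act_div _ _ (heq _ ⟨hq.1, le_rfl, hcd⟩)).symm
  · refine h₁.mono ?_
    rintro ⟨x, t⟩ ⟨hq, hf⟩
    rw [(isClosed_le continuous_snd continuous_const).closure_eq] at hf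
    exact ⟨hq.1, hq.2.1, hf⟩
  · refine hg.mono ?_
    rintro ⟨x, t⟩ ⟨hq, hf⟩
    have : closure {q : B × ℝ | ¬ q.2 ≤ c} ⊆ {q | c ≤ q.2} :=
      closure_minimal (fun q hq ↦ (not_le.1 hq).le) (isClosed_le continuous_const continuous_snd)
    exact ⟨hq.1, this hf, hq.2.2⟩
  · rintro ⟨x, t⟩ hq
    dsimp only
    split_ifs with h
    · exact h₁' _ ⟨hq.1, hq.2.1, h⟩
    · rw [T.proj_act]
      exact h₂' _ ⟨hq.1, (not_le.1 h).le, hq.2.2⟩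

/-- Local lifts of a homotopy exist near each point, for all times. -/
theorem IsSmoothTorsor.exists_local_lift (T : IsSmoothTorsor IH IP π act div) {e : B → M}
    (hloc : ∀ b, ∃ W : Set B, IsOpen W ∧ b ∈ W ∧ ∃ σ : B → P, ContinuousOn σ W ∧
      ∀ x ∈ W, π (σ x) = e x) {F : B × ℝ → B} (hF : Continuous F) (b : B) :
    ∃ W : Set B, IsOpen W ∧ b ∈ W ∧ ∃ θ : B × ℝ → P, ContinuousOn θ (W ×ˢ Icc 0 1) ∧
      ∀ q ∈ W ×ˢ Icc (0 : ℝ) 1, π (θ q) = e (F q) := by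
  choose V hVo hbV σ hσ hσ' using hloc
  -- Lebesgue number argument: `[0, 1]` is cut so that the path `F (b, ·)` maps each piece into one
  -- set with a local section. The division points are eventually `1`, so finitely many extensions
  -- suffice.
  obtain ⟨t, ht0, htm, ⟨m, hm⟩, hsub⟩ := exists_monotone_Icc_subset_open_cover_Icc
    (zero_le_one' ℝ) (c := fun i : B ↦ {t : Icc (0 : ℝ) 1 | F (b, t) ∈ V i})
    (fun i ↦ (hVo i).preimage (by fun_prop))
    (fun t _ ↦ mem_iUnion.2 ⟨F (b, t), hbV _⟩)
  have key : ∀ n, ∃ W : Set B, IsOpen W ∧ b ∈ W ∧ ∃ θ : B × ℝ → P,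
      ContinuousOn θ (W ×ˢ Icc 0 (t n : ℝ)) ∧
      ∀ q ∈ W ×ˢ Icc (0 : ℝ) (t n), π (θ q) = e (F q) := by
    -- By compactness of the time interval, what holds along the path of `b` holds for all points
    -- near `b`.
    have step : ∀ a c : ℝ, ∀ i, (∀ s ∈ Icc a c, F (b, s) ∈ V i) →
        ∃ W : Set B, IsOpen W ∧ b ∈ W ∧ ∀ q ∈ W ×ˢ Icc a c, F q ∈ V i := by
      intro a c i h
      obtain ⟨u, v, hu, -, hbu, hv, huv⟩ := generalized_tube_lemma (isCompact_singleton (x := b))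
        (isCompact_Icc (a := a) (b := c)) ((hVo i).preimage hF) (by
          rintro ⟨x, s⟩ ⟨hx, hs⟩
          obtain rfl : x = b := hx
          exact h s hs)
      exact ⟨u, hu, hbu rfl, fun q hq ↦ huv ⟨hq.1, hv hq.2⟩⟩
    intro n
    induction n with
    | zero =>
      obtain ⟨W, hW, hbW, h⟩ := step 0 0 (F (b, 0)) (fun s hs ↦ by
        rw [le_antisymm hs.2 hs.1]; exact hbV _)
      refine ⟨W, hW, hbW, fun q ↦ σ (F (b, 0)) (F q), ?_, ?_⟩ <;> rw [ht0]
      · exact (hσ _).comp hF.continuousOn h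
      · exact fun q hq ↦ hσ' _ _ (h q hq)
    | succ n ih =>
      obtain ⟨W₁, hW₁, hb₁, θ₁, h₁, h₁'⟩ := ih
      obtain ⟨i, hi⟩ := hsub n
      obtain ⟨W₂, hW₂, hb₂, h₂⟩ := step (t n) (t (n + 1)) i (fun s hs ↦
        hi (show (⟨s, (t n).2.1.trans hs.1, hs.2.trans (t (n + 1)).2.2⟩ : Icc (0 : ℝ) 1) ∈ _
          from hs))
      obtain ⟨θ, h, h'⟩ := T.exists_lift_union (F := e ∘ F) (W := W₁ ∩ W₂) (θ₁ := θ₁)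
        (θ₂ := fun q ↦ σ i (F q)) (t n).2.1 (htm n.le_succ)
        (h₁.mono (prod_mono_left inter_subset_left))
        (fun q hq ↦ h₁' q ⟨hq.1.1, hq.2⟩)
        (((hσ i).comp hF.continuousOn h₂).mono (prod_mono_left inter_subset_right))
        (fun q hq ↦ hσ' i _ (h₂ q ⟨hq.1.2, hq.2⟩))
      exact ⟨W₁ ∩ W₂, hW₁.inter hW₂, ⟨hb₁, hb₂⟩, θ, h, h'⟩
  have := key m
  rwa [hm m le_rfl] at this

/-- Every family of open neighbourhoods of the points of a manifold has a subordinate countable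
partition of unity. -/
theorem exists_nat_smoothPartitionOfUnity (EB : Type*) [NormedAddCommGroup EB] [NormedSpace ℝ EB]
    [FiniteDimensional ℝ EB] [ChartedSpace EB B] [IsManifold 𝓘(ℝ, EB) ∞ B] [T2Space B]
    [SecondCountableTopology B] 
    [Nonempty B] {W : B → Set B} (hW : ∀ b, IsOpen (W b))
    (hbW : ∀ b, b ∈ W b) : ∃ (c : ℕ → B) (f : SmoothPartitionOfUnity ℕ 𝓘(ℝ, EB) B univ),
      f.IsSubordinate (fun n ↦ W (c n)) := by
  have : LocallyCompactSpace B := ChartedSpace.locallyCompactSpace EB B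
  -- A countable subcover allows indexing by `ℕ`, which the later inductions and partial sums need.
  obtain ⟨s, hs, hsU⟩ := TopologicalSpace.countable_cover_nhds (fun b ↦ (hW b).mem_nhds (hbW b))
  have hne : s.Nonempty := by
    obtain ⟨b⟩ := ‹Nonempty B›
    have : b ∈ ⋃ x ∈ s, W x := hsU ▸ mem_univ b
    obtain ⟨x, hx, -⟩ := mem_iUnion₂.1 this
    exact ⟨x, hx⟩
  obtain ⟨c, rfl⟩ := hs.exists_eq_range hne
  refine ⟨c, SmoothPartitionOfUnity.exists_isSubordinate 𝓘(ℝ, EB) isClosed_univ _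
    (fun n ↦ hW (c n)) ?_⟩
  rw [← hsU, biUnion_range]

/-- The homotopy lifting property: if the constant map at `b₀` is homotopic to the identity of the
base manifold, then there is a continuous section. -/
theorem IsSmoothTorsor.exists_continuous_section (EB : Type*) [NormedAddCommGroup EB] [NormedSpace ℝ EB]
    [FiniteDimensional ℝ EB] [ChartedSpace EB B] [IsManifold 𝓘(ℝ, EB) ∞ B] [T2Space B]
    [SecondCountableTopology B] 
    (T : IsSmoothTorsor IH IP π act div) {e : B → M}
    (hloc : ∀ b, ∃ W : Set B, IsOpen W ∧ b ∈ W ∧ ∃ σ : B → P, ContinuousOn σ W ∧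
      ∀ x ∈ W, π (σ x) = e x) {F : B × ℝ → B} (hF : Continuous F) (b₀ : B)
    (hF₀ : ∀ x, F (x, 0) = b₀) (hF₁ : ∀ x, F (x, 1) = x) :
    ∃ s : B → P, Continuous s ∧ ∀ x, π (s x) = e x := by
  have : LocallyCompactSpace B := ChartedSpace.locallyCompactSpace EB B
  have : Nonempty B := ⟨b₀⟩
  choose W hWo hbW θ hθ hθ' using T.exists_local_lift hloc hF
  obtain ⟨c, f, hf⟩ := exists_nat_smoothPartitionOfUnity EB hWo hbW
  have hfin : LocallyFinite fun n ↦ tsupport (f n) := f.locallyFinite.closure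
  -- The partial sums climb from `0` to `1`. A section is built over the graph of each `τ n`, and
  -- passing from `τ n` to `τ (n + 1)` changes the time only on the support of `f n`, inside a set
  -- over which lifts exist for all times.
  let τ : ℕ → B → ℝ := fun n x ↦ ∑ j ∈ Finset.range n, f j x
  have hsum : ∀ x, ∀ᶠ n in Filter.atTop, τ n x = 1 := by
    intro x
    obtain ⟨K, hK⟩ := (f.locallyFinite.point_finite x).bddAbove
    filter_upwards [Filter.eventually_gt_atTop K] with n hn
    rw [← f.sum_eq_one (mem_univ x)]
    refine (finsum_eq_sum_of_support_subset _ fun j hj ↦ ?_).symm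
    exact Finset.mem_coe.2 (Finset.mem_range.2 ((hK hj).trans_lt hn))
  have hτmono : ∀ x, Monotone (fun n ↦ τ n x) := fun x ↦
    monotone_nat_of_le_succ fun n ↦ by
      simp only [τ, Finset.sum_range_succ]
      linarith [f.nonneg n x]
  have hτ0 : ∀ n x, 0 ≤ τ n x := fun n x ↦ Finset.sum_nonneg fun j _ ↦ f.nonneg j x
  have hτ1 : ∀ n x, τ n x ≤ 1 := by
    intro n x
    obtain ⟨m, hm, hm'⟩ := ((hsum x).and (Filter.eventually_ge_atTop n)).exists
    exact hm ▸ hτmono x hm'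
  have hτc : ∀ n, Continuous (τ n) := fun n ↦
    continuous_finsetSum _ fun j _ ↦ (f j).contMDiff.continuous
  have hτI : ∀ n x, τ n x ∈ Icc (0 : ℝ) 1 := fun n x ↦ ⟨hτ0 n x, hτ1 n x⟩
  have hτs : ∀ n x, x ∉ tsupport (f n) → τ (n + 1) x = τ n x := by
    intro n x hx
    simp only [τ, Finset.sum_range_succ, image_eq_zero_of_notMem_tsupport hx, add_zero]
  have step : ∀ n (s : {s : B → P // Continuous s ∧ ∀ x, π (s x) = e (F (x, τ n x))}),
      ∃ s' : {s : B → P // Continuous s ∧ ∀ x, π (s x) = e (F (x, τ (n + 1) x))},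
        ∀ x ∉ tsupport (f n), s'.1 x = s.1 x := by
    classical
    rintro n ⟨s, hs, hs'⟩
    have hmaps : ∀ m, ∀ x ∈ W (c n), (x, τ m x) ∈ W (c n) ×ˢ Icc (0 : ℝ) 1 := fun m x hx ↦
      ⟨hx, hτI m x⟩
    have hcomp : ∀ m, ContinuousOn (fun x ↦ θ (c n) (x, τ m x)) (W (c n)) := fun m ↦
      (hθ (c n)).comp (by have := hτc m; fun_prop) (hmaps m)
    have hpr : ∀ x ∈ W (c n), π (θ (c n) (x, τ n x)) = π (s x) := fun x hx ↦
      (hθ' _ _ (hmaps n x hx)).trans (hs' x).symm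
    -- The local lift is translated so that it passes through `s x` at time `τ n x`, then followed
    -- up to time `τ (n + 1) x`. Where these times agree, nothing moves.
    let g : B → P := fun x ↦ act (θ (c n) (x, τ (n + 1) x)) (div (θ (c n) (x, τ n x)) (s x))
    have hg : ContinuousOn g (W (c n)) := T.continuousOn_act_comp (hcomp _)
      (T.continuousOn_div_comp (hcomp _) hs.continuousOn hpr)
    have hgs : ∀ x ∈ W (c n), x ∉ tsupport (f n) → g x = s x := by
      intro x hx hx'
      simp only [g]
      rw [hτs n x hx', T.act_div _ _ (hpr x hx)]
    refine ⟨⟨fun x ↦ if x ∈ tsupport (f n) then g x else s x, ?_, ?_⟩, fun x hx ↦ if_neg hx⟩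
    · rw [continuous_iff_continuousAt]
      intro x
      by_cases hx : x ∈ tsupport (f n)
      · have hW : W (c n) ∈ 𝓝 x := (hWo _).mem_nhds (hf n hx)
        refine (hg.continuousAt hW).congr ?_
        filter_upwards [hW] with y hy
        split_ifs with h
        · rfl
        · exact hgs y hy h
      · refine hs.continuousAt.congr ?_
        filter_upwards [(isClosed_tsupport _).isOpen_compl.mem_nhds hx] with y hy
        exact (if_neg hy).symm
    · intro x
      dsimp only
      split_ifs with h
      · simp only [g]
        rw [T.proj_act, hθ' _ _ (hmaps _ x (hf n h))]
      · rw [hs', hτs n x h]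
  choose next hnext using step
  -- At time `0` the homotopy is constant at `b₀`, so one point of the fibre over `e b₀` serves as a
  -- constant initial lift.
  obtain ⟨W₀, -, hb₀, σ₀, -, hσ₀⟩ := hloc b₀
  let s : ∀ n, {s : B → P // Continuous s ∧ ∀ x, π (s x) = e (F (x, τ n x))} := fun n ↦
    Nat.rec ⟨fun _ ↦ σ₀ b₀, continuous_const, fun x ↦ by
      simp only [τ, Finset.range_zero, Finset.sum_empty, hF₀, hσ₀ b₀ hb₀]⟩ (fun n s ↦ next n s) n
  -- Only finitely many modifications meet a small neighbourhood of a given point, so the sequence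
  -- is eventually constant there; pointwise `τ n` is eventually `1`, and `F (x, 1) = x`.
  obtain ⟨S, hS⟩ := LocallyFinite.exists_forall_eventually_atTop_eventuallyEq
    (f := fun n ↦ (s n).1) (hfin.subset fun n x hx ↦ by
      by_contra h
      exact hx (hnext n (s n) x h))
  refine ⟨S, continuous_iff_continuousAt.2 fun x ↦ ?_, fun x ↦ ?_⟩
  · obtain ⟨n, hn⟩ := (hS x).exists
    exact (s n).2.1.continuousAt.congr hn
  · obtain ⟨n, hn, hn'⟩ := ((hS x).and (hsum x)).exists
    have := (s n).2.2 x
    rwa [hn.eq_of_nhds, hn', hF₁] at this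

end Torsor

/-! ### Smoothing a continuous section -/

section Smoothing

variable {EH EP HP : Type*} [NormedAddCommGroup EH] [NormedSpace ℝ EH]
  [NormedAddCommGroup EP] [NormedSpace ℝ EP] [TopologicalSpace HP]
  {H : Type*} [TopologicalSpace H] [ChartedSpace EH H] [IsManifold 𝓘(ℝ, EH) ∞ H]
  {IP : ModelWithCorners ℝ EP HP} {P : Type*} [TopologicalSpace P] [ChartedSpace HP P]
  {M : Type*} {π : P → M} {act : P → H → P} {div : P → P → H}
  {B : Type*} [TopologicalSpace B]
  {EB : Type*} [NormedAddCommGroup EB] [NormedSpace ℝ EB] [FiniteDimensional ℝ EB]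
  [ChartedSpace EB B] [IsManifold 𝓘(ℝ, EB) ∞ B] [T2Space B] [SecondCountableTopology B]

/-- A continuous map to a normed space can be approximated by a smooth one on a closed set,
staying in balls that are contained in a given neighbourhood of the graph. -/
theorem exists_contMDiff_approx_of_eventually {S W : Set B} (hS : IsClosed S) (hW : IsOpen W)
    (hSW : S ⊆ W) {f : B → EH} (hf : ContinuousOn f W) {Q : B → EH → Prop}
    (hQ : ∀ x ∈ S, ∀ᶠ q in 𝓝 (x, f x), Q q.1 q.2) :
    ∃ (ε : B → ℝ) (u : B → EH), ContMDiff 𝓘(ℝ, EB) 𝓘(ℝ, EH) ∞ u ∧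
      (∀ x ∈ S, dist (u x) (f x) < ε x) ∧ ∀ x ∈ S, ∀ v ∈ Metric.ball (f x) (ε x), Q x v := by
  have : LocallyCompactSpace B := ChartedSpace.locallyCompactSpace EB B
  -- Admissible radii form an interval, hence a convex set, so a smooth radius function can be glued
  -- from local constants. The approximation `u` is then found in the same way among the convex
  -- balls of that radius, with no condition off `S`.
  let t₁ : B → Set ℝ := fun x ↦ {r | 0 < r ∧ (x ∈ S → ∀ v ∈ Metric.ball (f x) r, Q x v)}
  have ht₁ : ∀ x, Convex ℝ (t₁ x) := by
    refine fun x ↦ OrdConnected.convex ⟨?_⟩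
    rintro r₁ ⟨h₁, -⟩ r₂ ⟨-, h₂⟩ r ⟨hr₁, hr₂⟩
    exact ⟨h₁.trans_le hr₁, fun hx v hv ↦ h₂ hx v (Metric.ball_subset_ball hr₂ hv)⟩
  have hfat : ∀ x ∈ S, ContinuousAt f x := fun x hx ↦ hf.continuousAt (hW.mem_nhds (hSW hx))
  obtain ⟨ε, hε⟩ := exists_contMDiffMap_forall_mem_convex_of_local_const (n := ⊤) 𝓘(ℝ, EB) ht₁ (by
    intro x
    by_cases hx : x ∈ S
    · have h := hQ x hx
      rw [nhds_prod_eq] at h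
      obtain ⟨p, hp, q, hq, hpq⟩ := Filter.eventually_prod_iff.1 h
      obtain ⟨r, hr, hrq⟩ := Metric.eventually_nhds_iff_ball.1 hq
      -- Half the radius leaves room for the centre to move: the ball about `f y` lies in the ball
      -- of radius `r` about `f x` once `f y` is within `r / 2` of `f x`.
      refine ⟨r / 2, ?_⟩
      filter_upwards [hp, (hfat x hx).eventually (Metric.ball_mem_nhds (f x) (half_pos hr))]
        with y hy hy'
      refine ⟨half_pos hr, fun _ v hv ↦ hpq hy (hrq v ?_)⟩
      have h1 : dist (f y) (f x) < r / 2 := hy'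
      have h2 : dist v (f y) < r / 2 := hv
      rw [Metric.mem_ball]
      linarith [dist_triangle v (f y) (f x)]
    · refine ⟨1, ?_⟩
      filter_upwards [hS.isOpen_compl.mem_nhds hx] with y hy
      exact ⟨one_pos, fun h ↦ absurd h hy⟩)
  let t₂ : B → Set EH := fun x ↦ {v | x ∈ S → v ∈ Metric.ball (f x) (ε x)}
  have ht₂ : ∀ x, Convex ℝ (t₂ x) := by
    intro x
    by_cases hx : x ∈ S
    · have : t₂ x = Metric.ball (f x) (ε x) := by ext; simp [t₂, hx]
      rw [this]
      exact convex_ball _ _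
    · have : t₂ x = univ := by ext; simp [t₂, hx]
      rw [this]
      exact convex_univ
  obtain ⟨u, hu⟩ := exists_contMDiffMap_forall_mem_convex_of_local_const (n := ⊤) 𝓘(ℝ, EB) ht₂ (by
    intro x
    refine ⟨f x, ?_⟩
    by_cases hx : x ∈ S
    · have h1 : ContinuousAt (fun y ↦ dist (f x) (f y) - ε y) x :=
        (continuousAt_const.dist (hfat x hx)).sub ε.contMDiff.continuous.continuousAt
      have h2 : dist (f x) (f x) - ε x < 0 := by
        rw [dist_self]
        linarith [(hε x).1]
      filter_upwards [h1.eventually_lt_const h2] with y hy _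
      exact sub_neg.1 hy
    · filter_upwards [hS.isOpen_compl.mem_nhds hx] with y hy
      exact fun h ↦ absurd h hy)
  exact ⟨ε, u, u.contMDiff, fun x hx ↦ hu x hx, fun x hx ↦ (hε x).2 hx⟩

/-- A continuous section can be deformed, within an open set of the bundle, to a section that is
smooth on a part of a trivialising open set. -/
theorem IsSmoothTorsor.exists_smoothing_step (T : IsSmoothTorsor 𝓘(ℝ, EH) IP π act div)
    {e : B → M} {W S v : Set B} {σ : B → P} (hW : IsOpen W)
    (hσ : ContMDiffOn 𝓘(ℝ, EB) IP ∞ σ W) (hσ' : ∀ x ∈ W, π (σ x) = e x) (h₀ : H)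
    (hS : IsClosed S) (hSW : S ⊆ W) {χ : B → ℝ} (hχ : ContMDiff 𝓘(ℝ, EB) 𝓘(ℝ, ℝ) ∞ χ)
    (hχI : ∀ x, χ x ∈ Icc (0 : ℝ) 1) (hχ₀ : ∀ x ∉ S, χ x = 0) (hv : IsOpen v)
    (hχ₁ : ∀ x ∈ v, χ x = 1) {Ω : B → P → Prop}
    (hΩ : ∀ x p, π p = e x → Ω x p → ∀ᶠ q in 𝓝 (x, p), π q.2 = e q.1 → Ω q.1 q.2)
    {s : B → P} (hs : Continuous s) (hs' : ∀ x, π (s x) = e x) (hsΩ : ∀ x, Ω x (s x))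
    (hchart : ∀ x ∈ S, div (σ x) (s x) ∈ (chartAt EH h₀).source) :
    ∃ s' : B → P, Continuous s' ∧ (∀ x, π (s' x) = e x) ∧ (∀ x, Ω x (s' x)) ∧
      (∀ x ∉ S, s' x = s x) ∧
      (∀ x, ContMDiffAt 𝓘(ℝ, EB) IP ∞ s x → ContMDiffAt 𝓘(ℝ, EB) IP ∞ s' x) ∧
      ∀ x ∈ v, ContMDiffAt 𝓘(ℝ, EB) IP ∞ s' x := by
  classical
  let c := extChartAt 𝓘(ℝ, EH) h₀
  have hct : IsOpen c.target := isOpen_extChartAt_target h₀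
  have hcs : IsOpen c.source := isOpen_extChartAt_source h₀
  have hdivW : ContinuousOn (fun x ↦ div (σ x) (s x)) W :=
    T.continuousOn_div_comp hσ.continuousOn hs.continuousOn
      (fun x hx ↦ (hσ' x hx).trans (hs' x).symm)
  let W' : Set B := W ∩ (fun x ↦ div (σ x) (s x)) ⁻¹' c.source
  have hW' : IsOpen W' := hdivW.isOpen_inter_preimage hW hcs
  have hSW' : S ⊆ W' := fun x hx ↦ ⟨hSW hx, by
    rw [mem_preimage, extChartAt_source]; exact hchart x hx⟩
  -- Relative to the smooth local section `σ` and a chart of `H`, the section `s` becomes a map `f`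
  -- to a vector space, and `g` turns such maps back into points of `P` in the right fibres.
  let f : B → EH := fun x ↦ c (div (σ x) (s x))
  have hf : ContinuousOn f W' :=
    (continuousOn_extChartAt h₀).comp (hdivW.mono inter_subset_left) (fun x hx ↦ hx.2)
  let g : B → EH → P := fun x w ↦ act (σ x) (c.symm w)
  have hft : ∀ x ∈ W', f x ∈ c.target := fun x hx ↦ c.map_source hx.2
  have hgf : ∀ x ∈ W', g x (f x) = s x := by
    intro x hx
    simp only [g, f]
    rw [c.left_inv hx.2, T.act_div _ _ ((hσ' x hx.1).trans (hs' x).symm)]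
  have hgπ : ∀ x ∈ W', ∀ w, π (g x w) = e x := fun x hx w ↦
    (T.proj_act _ _).trans (hσ' x hx.1)
  have hg : ContinuousOn (fun q : B × EH ↦ g q.1 q.2) (W ×ˢ c.target) :=
    T.continuousOn_act_comp (hσ.continuousOn.comp continuousOn_fst fun q hq ↦ hq.1)
      ((continuousOn_extChartAt_symm h₀).comp continuousOn_snd fun q hq ↦ hq.2)
  have hgs : ∀ {w : B → EH} {x : B}, x ∈ W → ContMDiffAt 𝓘(ℝ, EB) 𝓘(ℝ, EH) ∞ w x →
      w x ∈ c.target → ContMDiffAt 𝓘(ℝ, EB) IP ∞ (fun y ↦ g y (w y)) x := by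
    intro w x hx hw hwx
    refine ContMDiffAt.comp (g := fun q : P × H ↦ act q.1 q.2) x T.contMDiff_act.contMDiffAt
      (ContMDiffAt.prodMk (hσ.contMDiffAt (hW.mem_nhds hx)) ?_)
    exact ContMDiffAt.comp (g := c.symm) x
      ((contMDiffOn_extChartAt_symm h₀).contMDiffAt (hct.mem_nhds hwx)) hw
  obtain ⟨ε, u, hu, hu', hε⟩ := exists_contMDiff_approx_of_eventually (EB := EB) hS hW' hSW' hf
    (Q := fun x w ↦ w ∈ c.target ∧ Ω x (g x w)) (by
      intro x hx
      have hxW := hSW' hx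
      have h1 : ∀ᶠ q in 𝓝 (x, f x), q ∈ W' ×ˢ c.target :=
        (hW'.prod hct).mem_nhds ⟨hxW, hft x hxW⟩
      have h2 : ContinuousAt (fun q : B × EH ↦ (q.1, g q.1 q.2)) (x, f x) :=
        continuousAt_fst.prodMk (hg.continuousAt ((hW.prod hct).mem_nhds ⟨hxW.1, hft x hxW⟩))
      have h3 := hΩ x (s x) (hs' x) (hsΩ x)
      rw [← hgf x hxW] at h3
      filter_upwards [h1, h2.eventually h3] with q hq hq'
      exact ⟨hq.2, hq' (hgπ _ hq.1 _)⟩)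
  -- The interpolation equals the smooth `u` where `χ = 1` and the old `f` where `χ = 0`. On `S` it
  -- stays in the ball about `f x`, where both the chart and `Ω` are under control.
  let w : B → EH := fun x ↦ f x + χ x • (u x - f x)
  have hwε : ∀ x ∈ S, w x ∈ Metric.ball (f x) (ε x) := by
    intro x hx
    rw [mem_ball_iff_norm]
    simp only [w, add_sub_cancel_left, norm_smul]
    have h1 := hu' x hx
    rw [dist_eq_norm] at h1
    have h2 : ‖χ x‖ ≤ 1 := by
      rw [Real.norm_eq_abs, abs_of_nonneg (hχI x).1]
      exact (hχI x).2
    exact (mul_le_of_le_one_left (norm_nonneg _) h2).trans_lt h1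
  have hw : ContinuousOn w W' := hf.add
    (hχ.continuous.continuousOn.smul (hu.continuous.continuousOn.sub hf))
  have hwt : ∀ x ∈ S, w x ∈ c.target := fun x hx ↦ (hε x hx _ (hwε x hx)).1
  let s' : B → P := fun x ↦ if x ∈ S then g x (w x) else s x
  -- Off `S` the cutoff vanishes and `g x (w x)` is `s x`, so the formula is valid on all of the
  -- open set `W'`; this settles continuity and smoothness at the boundary of `S`.
  have hs'₁ : ∀ x ∈ W', s' x = g x (w x) := by
    intro x hx
    simp only [s']
    split_ifs with h
    · rfl
    · simp only [w, hχ₀ x h, zero_smul, add_zero]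
      exact (hgf x hx).symm
  have hs'₂ : ∀ x ∉ S, s' x = s x := fun x hx ↦ if_neg hx
  have hev₁ : ∀ x ∈ S, s' =ᶠ[𝓝 x] fun y ↦ g y (w y) := fun x hx ↦
    Filter.eventually_of_mem (hW'.mem_nhds (hSW' hx)) hs'₁
  have hev₂ : ∀ x ∉ S, s' =ᶠ[𝓝 x] s := fun x hx ↦
    Filter.eventually_of_mem (hS.isOpen_compl.mem_nhds hx) hs'₂
  refine ⟨s', continuous_iff_continuousAt.2 fun x ↦ ?_, fun x ↦ ?_, fun x ↦ ?_, hs'₂,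
    fun x hx ↦ ?_, fun x hx ↦ ?_⟩
  · by_cases hx : x ∈ S
    · refine ContinuousAt.congr ?_ (hev₁ x hx).symm
      have h1 : ContinuousAt (fun y ↦ (y, w y)) x :=
        continuousAt_id.prodMk (hw.continuousAt (hW'.mem_nhds (hSW' hx)))
      exact ContinuousAt.comp (g := fun q : B × EH ↦ g q.1 q.2) (f := fun y ↦ (y, w y))
        (hg.continuousAt ((hW.prod hct).mem_nhds ⟨hSW hx, hwt x hx⟩)) h1
    · exact hs.continuousAt.congr (hev₂ x hx).symm
  · by_cases hx : x ∈ S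
    · rw [hs'₁ x (hSW' hx)]
      exact hgπ x (hSW' hx) _
    · rw [hs'₂ x hx]
      exact hs' x
  · by_cases hx : x ∈ S
    · rw [hs'₁ x (hSW' hx)]
      exact (hε x hx _ (hwε x hx)).2
    · rw [hs'₂ x hx]
      exact hsΩ x
  · by_cases hxS : x ∈ S
    · refine ContMDiffAt.congr_of_eventuallyEq ?_ (hev₁ x hxS)
      refine hgs (hSW hxS) ?_ (hwt x hxS)
      have h1 : ContMDiffWithinAt 𝓘(ℝ, EB) 𝓘(ℝ, EH) ∞ (fun y ↦ div (σ y) (s y)) W x :=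
        ContMDiffWithinAt.comp (g := fun q : P × P ↦ div q.1 q.2) (t := {q : P × P | π q.1 = π q.2}) x
          (T.contMDiffOn_div _ ((hσ' x (hSW hxS)).trans (hs' x).symm))
          ((hσ x (hSW hxS)).prodMk hx.contMDiffWithinAt)
          (fun y hy ↦ (hσ' y hy).trans (hs' y).symm)
      have h2 : ContMDiffAt 𝓘(ℝ, EB) 𝓘(ℝ, EH) ∞ f x :=
        ContMDiffAt.comp (g := c) x (contMDiffAt_extChartAt' (hchart x hxS))
          (h1.contMDiffAt (hW.mem_nhds (hSW hxS)))
      exact h2.add (hχ.contMDiffAt.smul (hu.contMDiffAt.sub h2))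
    · exact hx.congr_of_eventuallyEq (hev₂ x hxS)
  · have hxS : x ∈ S := by
      by_contra h
      exact one_ne_zero ((hχ₁ x hx).symm.trans (hχ₀ x h))
    have hwu : ∀ y ∈ v, w y = u y := fun y hy ↦ by
      simp only [w, hχ₁ y hy, one_smul, add_sub_cancel]
    refine ContMDiffAt.congr_of_eventuallyEq (hgs (w := u) (hSW hxS) hu.contMDiffAt ?_) ?_
    · rw [← hwu x hx]
      exact hwt x hxS
    · filter_upwards [hev₁ x hxS, hv.mem_nhds hx] with y hy hy'
      rw [hy, hwu y hy']

/-- If there is a continuous section, then there is a smooth one. -/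
theorem IsSmoothTorsor.exists_contMDiff_section_of_continuous
    (T : IsSmoothTorsor 𝓘(ℝ, EH) IP π act div) {e : B → M}
    (hloc : ∀ b, ∃ W : Set B, IsOpen W ∧ b ∈ W ∧ ∃ σ : B → P,
      ContMDiffOn 𝓘(ℝ, EB) IP ∞ σ W ∧ ∀ x ∈ W, π (σ x) = e x)
    {s₀ : B → P} (hs₀ : Continuous s₀) (hs₀' : ∀ x, π (s₀ x) = e x) :
    ∃ s : B → P, ContMDiff 𝓘(ℝ, EB) IP ∞ s ∧ ∀ x, π (s x) = e x := by
  have : LocallyCompactSpace B := ChartedSpace.locallyCompactSpace EB B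
  rcases isEmpty_or_nonempty B with hB | hB
  · exact ⟨s₀, fun x ↦ hB.elim x, hs₀'⟩
  -- Shrinking the domains makes the division of `s₀` by `σ` land in a single chart of `H`.
  have hloc' : ∀ b, ∃ W : Set B, IsOpen W ∧ b ∈ W ∧ ∃ (σ : B → P) (h : H),
      ContMDiffOn 𝓘(ℝ, EB) IP ∞ σ W ∧ (∀ x ∈ W, π (σ x) = e x) ∧
      ∀ x ∈ W, div (σ x) (s₀ x) ∈ (chartAt EH h).source := by
    intro b
    obtain ⟨W, hW, hb, σ, hσ, hσ'⟩ := hloc b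
    have hdivW : ContinuousOn (fun x ↦ div (σ x) (s₀ x)) W :=
      T.continuousOn_div_comp hσ.continuousOn hs₀.continuousOn
        (fun x hx ↦ (hσ' x hx).trans (hs₀' x).symm)
    exact ⟨_, hdivW.isOpen_inter_preimage hW (chartAt EH (div (σ b) (s₀ b))).open_source,
      ⟨hb, mem_chart_source EH _⟩, σ, div (σ b) (s₀ b), hσ.mono inter_subset_left,
      fun x hx ↦ hσ' x hx.1, fun x hx ↦ hx.2⟩
  choose W hWo hbW σ h hσ hσ' hh using hloc'
  obtain ⟨c, f, hf⟩ := exists_nat_smoothPartitionOfUnity EB hWo hbW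
  have hfin : LocallyFinite fun n ↦ tsupport (f n) := f.locallyFinite.closure
  have hcov : ⋃ n, support (f n) = univ := eq_univ_of_forall fun x ↦ by
    obtain ⟨n, hn⟩ := f.exists_pos_of_mem (mem_univ x)
    exact mem_iUnion.2 ⟨n, hn.ne'⟩
  -- The sets `v n` still cover, with closures inside the supports. Stage `n` achieves smoothness on
  -- `v n` by a cutoff that is `1` there.
  obtain ⟨v, hv, hvo, hvs⟩ := exists_iUnion_eq_closure_subset
    (fun n ↦ (f n).contMDiff.continuous.isOpen_support) f.locallyFinite.point_finite hcov
  have hχ : ∀ n, ∃ χ : C^∞⟮𝓘(ℝ, EB), B; 𝓘(ℝ), ℝ⟯, EqOn χ 0 (support (f n))ᶜ ∧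
      EqOn χ 1 (closure (v n)) ∧ ∀ x, χ x ∈ Icc (0 : ℝ) 1 := fun n ↦
    exists_contMDiffMap_zero_one_of_isClosed 𝓘(ℝ, EB)
      (f n).contMDiff.continuous.isOpen_support.isClosed_compl isClosed_closure
      (disjoint_compl_left_iff_subset.2 (hvs n))
  choose χ hχ₀ hχ₁ hχI using hχ
  -- Invariant of the induction: over each `tsupport (f n)` the section remains within the chart
  -- used at stage `n`. Preserving it for all indices at once keeps every later stage possible.
  let Ω : B → P → Prop := fun x p ↦ ∀ n, x ∈ tsupport (f n) →
    div (σ (c n) x) p ∈ (chartAt EH (h (c n))).source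
  have hΩ : ∀ x p, π p = e x → Ω x p → ∀ᶠ q in 𝓝 (x, p), π q.2 = e q.1 → Ω q.1 q.2 := by
    intro x p hp hxp
    have h1 : ∀ n ∈ {n | x ∈ tsupport (f n)}, ∀ᶠ q in 𝓝 (x, p), π q.2 = e q.1 →
        div (σ (c n) q.1) q.2 ∈ (chartAt EH (h (c n))).source := by
      intro n hn
      have hxW : x ∈ W (c n) := hf n hn
      have hcont : ContinuousOn (fun q : B × P ↦ div (σ (c n) q.1) q.2)
          {q | q.1 ∈ W (c n) ∧ π q.2 = e q.1} :=
        T.continuousOn_div_comp ((hσ (c n)).continuousOn.comp continuousOn_fst fun q hq ↦ hq.1)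
          continuousOn_snd fun q hq ↦ (hσ' _ _ hq.1).trans hq.2.symm
      have h2 := (hcont (x, p) ⟨hxW, hp⟩).eventually
        ((chartAt EH (h (c n))).open_source.mem_nhds (hxp n hn))
      rw [eventually_nhdsWithin_iff] at h2
      filter_upwards [h2, continuousAt_fst.eventually ((hWo (c n)).mem_nhds hxW)] with q hq hq' hq''
      exact hq ⟨hq', hq''⟩
    -- By local finiteness, near `x` the only relevant indices are the finitely many whose supports
    -- contain `x`, so `Ω` is an open condition within the fibre product.
    have h2 := (Filter.eventually_all_finite (hfin.point_finite x)).2 h1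
    filter_upwards [h2, continuousAt_fst.eventually
      (hfin.eventually_subset (fun n ↦ isClosed_tsupport _) x)] with q hq hq' hq'' n hn
    exact hq n (hq' hn) hq''
  let Good : (B → P) → Prop := fun s ↦ Continuous s ∧ (∀ x, π (s x) = e x) ∧ ∀ x, Ω x (s x)
  have step : ∀ n (s : {s // Good s}), ∃ s' : {s // Good s},
      (∀ x ∉ tsupport (f n), s'.1 x = s.1 x) ∧
      (∀ x, ContMDiffAt 𝓘(ℝ, EB) IP ∞ s.1 x → ContMDiffAt 𝓘(ℝ, EB) IP ∞ s'.1 x) ∧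
      ∀ x ∈ v n, ContMDiffAt 𝓘(ℝ, EB) IP ∞ s'.1 x := by
    rintro n ⟨s, hs, hs', hsΩ⟩
    obtain ⟨s', h1, h2, h3, h4⟩ := T.exists_smoothing_step (hWo (c n)) (hσ (c n)) (hσ' (c n))
      (h (c n)) (isClosed_tsupport (f n)) (hf n) (χ n).contMDiff (hχI n)
      (fun x hx ↦ hχ₀ n fun hx' ↦ hx (subset_tsupport _ hx')) (hvo n)
      (fun x hx ↦ hχ₁ n (subset_closure hx)) hΩ hs hs' hsΩ (fun x hx ↦ hsΩ x n hx)
    exact ⟨⟨s', h1, h2, h3⟩, h4⟩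
  choose next hnext₁ hnext₂ hnext₃ using step
  let s : ℕ → {s // Good s} := fun n ↦
    Nat.rec ⟨s₀, hs₀, hs₀', fun x n hx ↦ hh _ _ (hf n hx)⟩ (fun n s ↦ next n s) n
  obtain ⟨S, hS⟩ := LocallyFinite.exists_forall_eventually_atTop_eventuallyEq
    (f := fun n ↦ (s n).1) (hfin.subset fun n x hx ↦ by
      by_contra hx'
      exact hx (hnext₁ n (s n) x hx'))
  refine ⟨S, fun x ↦ ?_, fun x ↦ ?_⟩
  · obtain ⟨m, hm⟩ := mem_iUnion.1 (hv ▸ mem_univ x : x ∈ ⋃ n, v n)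
    -- Smoothness at `x ∈ v m` is gained at stage `m` and no later stage destroys it.
    have hsm : ∀ n ≥ m + 1, ContMDiffAt 𝓘(ℝ, EB) IP ∞ (s n).1 x := fun n hn ↦
      Nat.le_induction (hnext₃ m (s m) x hm) (fun k _ hk ↦ hnext₂ k (s k) x hk) n hn
    obtain ⟨n, hn, hn'⟩ := ((hS x).and (Filter.eventually_ge_atTop (m + 1))).exists
    exact (hsm n hn').congr_of_eventuallyEq hn.symm
  · obtain ⟨n, hn⟩ := (hS x).exists
    rw [← hn.eq_of_nhds]
    exact (s n).2.2.1 x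

/-- A smooth torsor with local sections over a contractible manifold has a smooth section. -/
theorem IsSmoothTorsor.exists_contMDiff_section [ContractibleSpace B]
    (T : IsSmoothTorsor 𝓘(ℝ, EH) IP π act div) {e : B → M}
    (hloc : ∀ b, ∃ W : Set B, IsOpen W ∧ b ∈ W ∧ ∃ σ : B → P,
      ContMDiffOn 𝓘(ℝ, EB) IP ∞ σ W ∧ ∀ x ∈ W, π (σ x) = e x) :
    ∃ s : B → P, ContMDiff 𝓘(ℝ, EB) IP ∞ s ∧ ∀ x, π (s x) = e x := by
  obtain ⟨b₀, ⟨F⟩⟩ := id_nullhomotopic B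
  -- The nullhomotopy starts at the identity, while lifting must start at the constant map; hence
  -- the reversed time `1 - q.2`, with `projIcc` extending the homotopy to all real times.
  obtain ⟨s₀, hs₀, hs₀'⟩ := T.exists_continuous_section EB (e := e)
    (fun b ↦ by
      obtain ⟨W, hW, hb, σ, hσ, hσ'⟩ := hloc b
      exact ⟨W, hW, hb, σ, hσ.continuousOn, hσ'⟩)
    (F := fun q ↦ F (projIcc 0 1 zero_le_one (1 - q.2), q.1)) (by fun_prop) b₀
    (fun x ↦ by simp) (fun x ↦ by simp)
  exact T.exists_contMDiff_section_of_continuous hloc hs₀ hs₀'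

end Smoothing

/-! ### Local sections of submersions -/

section Submersion

variable {ER EN : Type*} [NormedAddCommGroup ER] [NormedSpace ℝ ER]
  [NormedAddCommGroup EN] [NormedSpace ℝ EN]
  {R : Type*} [TopologicalSpace R] [ChartedSpace ER R]
  {Γ : Type*} [TopologicalSpace Γ] [ChartedSpace EN Γ]

/-- A submersion has smooth local sections. -/
theorem Manifold.IsSubmersion.exists_local_section {φ : R → Γ}
    (hφ : Manifold.IsSubmersion 𝓘(ℝ, ER) 𝓘(ℝ, EN) ∞ φ) (r : R) :
    ∃ W : Set Γ, IsOpen W ∧ φ r ∈ W ∧ ∃ σ : Γ → R, ContMDiffOn 𝓘(ℝ, EN) 𝓘(ℝ, ER) ∞ σ W ∧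
      ∀ y ∈ W, φ (σ y) = y := by
  obtain ⟨F, _, _, h⟩ := hφ.isSubmersionAt r
  let d := h.domChart.extend 𝓘(ℝ, ER)
  let c := h.codChart.extend 𝓘(ℝ, EN)
  let A := h.equiv
  have hw : ∀ z ∈ d.target, c (φ (d.symm z)) = (A z).1 := h.writtenInCharts
  have hrd : r ∈ d.source := by
    rw [h.domChart.extend_source]; exact h.mem_domChart_source
  have hds : ∀ x ∈ d.source, φ x ∈ c.source := by
    intro x hx
    rw [h.domChart.extend_source] at hx
    rw [h.codChart.extend_source]
    exact h.source_subset_preimage_source hx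
  have hcs : IsOpen c.source := by
    rw [h.codChart.extend_source]; exact h.codChart.open_source
  have hdt : IsOpen d.target := h.domChart.isOpen_extend_target
  -- In adapted charts `φ` is a linear projection; the section freezes the complementary coordinate
  -- at its value for `r`, so that it passes through `r`.
  let ζ : Γ → ER := fun y ↦ A.symm (c y, (A (d r)).2)
  have hc : ContMDiffOn 𝓘(ℝ, EN) 𝓘(ℝ, EN) ∞ c c.source := by
    rw [h.codChart.extend_source]
    exact h.codChart.contMDiffOn_extend h.codChart_mem_maximalAtlas
  have hζ : ContMDiffOn 𝓘(ℝ, EN) 𝓘(ℝ, ER) ∞ ζ c.source := by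
    have h1 : ContMDiff 𝓘(ℝ, EN) 𝓘(ℝ, ER) ∞ (fun w : EN ↦ A.symm (w, (A (d r)).2)) := by
      rw [contMDiff_iff_contDiff]
      fun_prop
    exact h1.comp_contMDiffOn hc
  have hζr : ζ (φ r) = d r := by
    have h1 := hw (d r) (d.map_source hrd)
    rw [d.left_inv hrd] at h1
    simp only [ζ, h1]
    exact A.symm_apply_apply _
  refine ⟨c.source ∩ ζ ⁻¹' d.target, hζ.continuousOn.isOpen_inter_preimage hcs hdt,
    ⟨hds r hrd, ?_⟩, fun y ↦ d.symm (ζ y), ?_, ?_⟩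
  · rw [mem_preimage, hζr]
    exact d.map_source hrd
  · have h1 : ContMDiffOn 𝓘(ℝ, ER) 𝓘(ℝ, ER) ∞ d.symm d.target := by
      have h2 := contMDiffOn_extend_symm (I := 𝓘(ℝ, ER)) h.domChart_mem_maximalAtlas
      refine h2.mono ?_
      simp [d]
    exact h1.comp (hζ.mono inter_subset_left) fun y hy ↦ hy.2
  · rintro y ⟨hy, hy'⟩
    refine c.injOn (hds _ (d.map_target hy')) hy ?_
    rw [hw _ hy']
    simp only [ζ, A.apply_symm_apply]

end Submersion

/-! ### Disjoint unions of open subsets: smoothness, submersions, sections -/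

section Sigma

variable {EN : Type*} [NormedAddCommGroup EN] [NormedSpace ℝ EN] {N : Type*} [TopologicalSpace N]
  [ChartedSpace EN N] {κ : Type*} {V : κ → Opens N}

theorem contMDiff_sigmaOpens_mk (k : κ) :
    ContMDiff 𝓘(ℝ, EN) 𝓘(ℝ, EN) ∞ (fun x : V k ↦ (⟨k, x⟩ : Σ k, V k)) := fun _ ↦
  contMDiffWithinAt_sigmaOpens (Filter.Eventually.of_forall fun _ ↦ rfl)
    contMDiff_subtype_val.contMDiffAt

variable [IsManifold 𝓘(ℝ, EN) ∞ N]

/-- A map from a disjoint union of open subsets is smooth if it is so on each piece. -/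
theorem contMDiff_of_sigmaOpens {EP HP : Type*} [NormedAddCommGroup EP] [NormedSpace ℝ EP]
    [TopologicalSpace HP] {IP : ModelWithCorners ℝ EP HP} {P : Type*} [TopologicalSpace P]
    [ChartedSpace HP P] {f : (Σ k, V k) → P}
    (hf : ∀ k, ContMDiff 𝓘(ℝ, EN) IP ∞ (fun x : V k ↦ f ⟨k, x⟩)) :
    ContMDiff 𝓘(ℝ, EN) IP ∞ f := by
  classical
  rintro ⟨k, x⟩
  -- The value off `V k` is arbitrary, since only the germ at a point of the open set `V k` matters.
  let g : N → P := fun y ↦ if h : y ∈ V k then f ⟨k, ⟨y, h⟩⟩ else f ⟨k, x⟩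
  have hg : ContMDiffAt 𝓘(ℝ, EN) IP ∞ g (x : N) := by
    rw [← contMDiffAt_subtype_iff]
    have : (fun y : V k ↦ g y) = fun y : V k ↦ f ⟨k, y⟩ := funext fun y ↦ dif_pos y.2
    rw [this]
    exact hf k x
  have h1 : ContMDiffAt 𝓘(ℝ, EN) IP ∞ (fun q : Σ k, V k ↦ g q.2) ⟨k, x⟩ :=
    ContMDiffAt.comp (g := g) (⟨k, x⟩ : Σ k, V k) hg
      (contMDiff_sigmaOpens_val 𝓘(ℝ, EN) V).contMDiffAt
  refine h1.congr_of_eventuallyEq ?_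
  filter_upwards [sigma_fst_eventually (⟨k, x⟩ : Σ k, V k)] with q hq
  obtain ⟨l, y⟩ := q
  obtain rfl : l = k := hq
  have : g y = f ⟨l, y⟩ := dif_pos y.2
  exact this.symm

/-- The projection from the product of a manifold and a disjoint union of open subsets of `N`,
followed by a map that preserves the points of `N` and the partition into pieces, is a
submersion. -/
theorem isSubmersion_snd_sigmaOpens {EG : Type*} [NormedAddCommGroup EG] [NormedSpace ℝ EG]
    (G : Type*) [TopologicalSpace G] [ChartedSpace EG G] [IsManifold 𝓘(ℝ, EG) ∞ G]
    {κ' : Type*} {W : κ' → Opens N} (f : (Σ k, V k) → Σ k, W k) (σ : κ → κ')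
    (hf : ∀ q, (f q).1 = σ q.1) (hf' : ∀ q, ((f q).2 : N) = q.2) :
    Manifold.IsSubmersion (𝓘(ℝ, EG).prod 𝓘(ℝ, EN)) 𝓘(ℝ, EN) ∞
      (fun q : G × (Σ k, V k) ↦ f q.2) := by
  refine Manifold.IsSubmersionOfComplement.isSubmersion (F := EG) fun ⟨g, p⟩ ↦ ?_
  have hcont : ContinuousAt (fun q : G × (Σ k, V k) ↦ f q.2) (g, p) :=
    ((isSubmersion_sigmaOpens 𝓘(ℝ, EN) f σ hf hf').contMDiff.continuous.comp
      continuous_snd).continuousAt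
  -- The complement is the model space of `G`; swapping the factors puts the base coordinate first,
  -- as the normal form requires.
  refine Manifold.IsSubmersionAtOfComplement.mk_of_continuousAt hcont
    (ContinuousLinearEquiv.prodComm ℝ EG EN)
    (chartAt (ModelProd EG EN) ((g, p) : G × (Σ k, V k))) (chartAt EN (f p))
    (mem_chart_source _ _) (mem_chart_source _ _) (IsManifold.chart_mem_maximalAtlas _)
    (IsManifold.chart_mem_maximalAtlas _) ?_
  intro z hz
  change extChartAt 𝓘(ℝ, EN) (f p) (f ((extChartAt (𝓘(ℝ, EG).prod 𝓘(ℝ, EN)) (g, p)).symm z).2)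
    = z.2
  have hz' : z ∈ (extChartAt (𝓘(ℝ, EG).prod 𝓘(ℝ, EN)) (g, p)).target := hz
  rw [extChartAt_prod] at hz' ⊢
  rw [PartialEquiv.prod_target] at hz'
  change extChartAt 𝓘(ℝ, EN) (f p) (f ((extChartAt 𝓘(ℝ, EN) p).symm z.2)) = z.2
  have h1 : ((extChartAt 𝓘(ℝ, EN) p).symm z.2).1 = p.1 := by
    have := (extChartAt 𝓘(ℝ, EN) p).map_target hz'.2
    rw [extChartAt_source] at this
    obtain ⟨y, -, hy⟩ := this
    rw [← hy]
  rw [sigmaOpens_extChartAt 𝓘(ℝ, EN) W _ _ (by rw [hf, hf, h1]), hf', hf',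
    ← sigmaOpens_extChartAt 𝓘(ℝ, EN) V _ _ h1, (extChartAt 𝓘(ℝ, EN) p).right_inv hz'.2]

/-- A smooth torsor with local sections over a disjoint union of contractible open subsets of `N`
has a smooth section. -/
theorem IsSmoothTorsor.exists_section_sigmaOpens [FiniteDimensional ℝ EN] [T2Space N]
    [SecondCountableTopology N]
    {EH EP HP : Type*} [NormedAddCommGroup EH] [NormedSpace ℝ EH]
    [NormedAddCommGroup EP] [NormedSpace ℝ EP] [TopologicalSpace HP]
    {H : Type*} [TopologicalSpace H] [ChartedSpace EH H] [IsManifold 𝓘(ℝ, EH) ∞ H]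
    {IP : ModelWithCorners ℝ EP HP} {P : Type*} [TopologicalSpace P] [ChartedSpace HP P]
    {π : P → Σ k, V k} {act : P → H → P} {div : P → P → H}
    (T : IsSmoothTorsor 𝓘(ℝ, EH) IP π act div)
    (hV : ∀ k, (V k : Set N).Nonempty → ContractibleSpace (V k))
    (hloc : ∀ b, ∃ W : Set (Σ k, V k), IsOpen W ∧ b ∈ W ∧ ∃ σ : (Σ k, V k) → P,
      ContMDiffOn 𝓘(ℝ, EN) IP ∞ σ W ∧ ∀ x ∈ W, π (σ x) = x) :
    ∃ s : (Σ k, V k) → P, ContMDiff 𝓘(ℝ, EN) IP ∞ s ∧ ∀ q, π (s q) = q := by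
  have key : ∀ k, ∃ s : V k → P, ContMDiff 𝓘(ℝ, EN) IP ∞ s ∧ ∀ x, π (s x) = ⟨k, x⟩ := by
    intro k
    rcases isEmpty_or_nonempty (V k) with hk | ⟨⟨x, hx⟩⟩
    · exact ⟨fun x ↦ hk.elim x, fun x ↦ hk.elim x, fun x ↦ hk.elim x⟩
    have := hV k ⟨x, hx⟩
    refine T.exists_contMDiff_section (e := fun x : V k ↦ (⟨k, x⟩ : Σ k, V k)) fun b ↦ ?_
    obtain ⟨W, hW, hb, σ, hσ, hσ'⟩ := hloc ⟨k, b⟩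
    have hmk := contMDiff_sigmaOpens_mk (EN := EN) (V := V) k
    exact ⟨_, hW.preimage hmk.continuous, hb, _, hσ.comp hmk.contMDiffOn fun x hx ↦ hx,
      fun x hx ↦ hσ' _ hx⟩
  choose s hs hs' using key
  exact ⟨fun q ↦ s q.1 q.2, contMDiff_of_sigmaOpens hs, fun q ↦ hs' q.1 q.2⟩

end Sigma

/-! ### Transport of extensions along diffeomorphisms -/

section Transport

variable {EM HM EΓ HΓ EG HG EH HH ER HR EP HP ER' HR' EP' HP' : Type*}
  [NormedAddCommGroup EM] [NormedSpace ℝ EM] [TopologicalSpace HM]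
  [NormedAddCommGroup EΓ] [NormedSpace ℝ EΓ] [TopologicalSpace HΓ]
  [NormedAddCommGroup EG] [NormedSpace ℝ EG] [TopologicalSpace HG]
  [NormedAddCommGroup EH] [NormedSpace ℝ EH] [TopologicalSpace HH]
  [NormedAddCommGroup ER] [NormedSpace ℝ ER] [TopologicalSpace HR]
  [NormedAddCommGroup EP] [NormedSpace ℝ EP] [TopologicalSpace HP]
  [NormedAddCommGroup ER'] [NormedSpace ℝ ER'] [TopologicalSpace HR']
  [NormedAddCommGroup EP'] [NormedSpace ℝ EP'] [TopologicalSpace HP']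
  {IM : ModelWithCorners ℝ EM HM} {M : Type*} [TopologicalSpace M] [ChartedSpace HM M]
  [IsManifold IM ∞ M]
  {IΓ : ModelWithCorners ℝ EΓ HΓ} {Γ : Type*} [TopologicalSpace Γ] [ChartedSpace HΓ Γ]
  [IsManifold IΓ ∞ Γ]
  {IG : ModelWithCorners ℝ EG HG} {G : Type*} [TopologicalSpace G] [ChartedSpace HG G] [Group G]
  [LieGroup IG ∞ G]
  {IH : ModelWithCorners ℝ EH HH} {H : Type*} [TopologicalSpace H] [ChartedSpace HH H] [Group H]
  [LieGroup IH ∞ H]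
  {IR : ModelWithCorners ℝ ER HR} {R : Type*} [TopologicalSpace R] [ChartedSpace HR R]
  [IsManifold IR ∞ R]
  {IP : ModelWithCorners ℝ EP HP} {P : Type*} [TopologicalSpace P] [ChartedSpace HP P]
  [IsManifold IP ∞ P]
  {IR' : ModelWithCorners ℝ ER' HR'} {R' : Type*} [TopologicalSpace R'] [ChartedSpace HR' R']
  [IsManifold IR' ∞ R']
  {IP' : ModelWithCorners ℝ EP' HP'} {P' : Type*} [TopologicalSpace P'] [ChartedSpace HP' P']
  [IsManifold IP' ∞ P']

/-- The Lie groupoid structure transported along a diffeomorphism of the manifold of arrows. -/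
def LieGroupoid.transport (𝒜 : LieGroupoid IM M IR R) (Φ : Diffeomorph IR IR' R R' ∞)
    (hsrc : Manifold.IsSubmersion IR' IM ∞ (fun r ↦ 𝒜.src (Φ.symm r)))
    (htgt : Manifold.IsSubmersion IR' IM ∞ (fun r ↦ 𝒜.tgt (Φ.symm r))) :
    LieGroupoid IM M IR' R' where
  src r := 𝒜.src (Φ.symm r)
  tgt r := 𝒜.tgt (Φ.symm r)
  unit m := Φ (𝒜.unit m)
  inv r := Φ (𝒜.inv (Φ.symm r))
  mul a b := Φ (𝒜.mul (Φ.symm a) (Φ.symm b))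
  src_unit m := by simp only [Φ.symm_apply_apply, 𝒜.src_unit]
  tgt_unit m := by simp only [Φ.symm_apply_apply, 𝒜.tgt_unit]
  src_inv a := by simp only [Φ.symm_apply_apply, 𝒜.src_inv]
  tgt_inv a := by simp only [Φ.symm_apply_apply, 𝒜.tgt_inv]
  src_mul a b h := by simp only [Φ.symm_apply_apply, 𝒜.src_mul _ _ h]
  tgt_mul a b h := by simp only [Φ.symm_apply_apply, 𝒜.tgt_mul _ _ h]
  mul_assoc a b c h h' := by simp only [Φ.symm_apply_apply, 𝒜.mul_assoc _ _ _ h h']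
  unit_mul a := by simp only [Φ.symm_apply_apply, 𝒜.unit_mul, Φ.apply_symm_apply]
  mul_unit a := by simp only [Φ.symm_apply_apply, 𝒜.mul_unit, Φ.apply_symm_apply]
  mul_inv a := by simp only [Φ.symm_apply_apply, 𝒜.mul_inv]
  inv_mul a := by simp only [Φ.symm_apply_apply, 𝒜.inv_mul]
  isSubmersion_src := hsrc
  isSubmersion_tgt := htgt
  contMDiff_unit := Φ.contMDiff.comp 𝒜.contMDiff_unit
  contMDiff_inv := Φ.contMDiff.comp (𝒜.contMDiff_inv.comp Φ.symm.contMDiff)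
  contMDiffOn_mul := Φ.contMDiff.comp_contMDiffOn (𝒜.contMDiffOn_mul.comp
    (Φ.symm.contMDiff.prodMap Φ.symm.contMDiff).contMDiffOn fun _ hq ↦ hq)

variable {𝒢 : LieGroupoid IM M IΓ Γ} {C : LieCrossedModule IG G IH H}

/-- The extension transported along a diffeomorphism of the manifold of arrows. -/
def LieGroupoidExtension.transport (X : LieGroupoidExtension 𝒢 IR R)
    (Φ : Diffeomorph IR IR' R R' ∞)
    (hsrc : Manifold.IsSubmersion IR' IM ∞ (fun r ↦ X.src (Φ.symm r)))
    (htgt : Manifold.IsSubmersion IR' IM ∞ (fun r ↦ X.tgt (Φ.symm r)))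
    (hφ : Manifold.IsSubmersion IR' IΓ ∞ (fun r ↦ X.φ (Φ.symm r))) :
    LieGroupoidExtension 𝒢 IR' R' where
  toLieGroupoid := X.toLieGroupoid.transport Φ hsrc htgt
  φ r := X.φ (Φ.symm r)
  src_φ _ := X.src_φ _
  tgt_φ _ := X.tgt_φ _
  φ_mul _ _ h := (congrArg X.φ (Φ.symm_apply_apply _)).trans (X.φ_mul _ _ h)
  φ_unit m := (congrArg X.φ (Φ.symm_apply_apply _)).trans (X.φ_unit m)
  surjective_φ := X.surjective_φ.comp Φ.symm.surjective
  isSubmersion_φ := hφ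

section

variable (X : LieGroupoidExtension 𝒢 IR R) (Φ : Diffeomorph IR IR' R R' ∞)
  (hsrc : Manifold.IsSubmersion IR' IM ∞ (fun r ↦ X.src (Φ.symm r)))
  (htgt : Manifold.IsSubmersion IR' IM ∞ (fun r ↦ X.tgt (Φ.symm r)))
  (hφ : Manifold.IsSubmersion IR' IΓ ∞ (fun r ↦ X.φ (Φ.symm r)))

theorem LieGroupoidExtension.isGroupExtension_transport (hX : X.IsGroupExtension IG G) :
    (X.transport Φ hsrc htgt hφ).IsGroupExtension IG G := by
  intro m₀
  obtain ⟨V, hV, hm, τ, θ, hτ, hθ, h⟩ := hX m₀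
  refine ⟨V, hV, hm, fun q ↦ Φ (τ q), fun r ↦ θ (Φ.symm r), Φ.contMDiff.comp_contMDiffOn hτ,
    hθ.comp Φ.symm.contMDiff.contMDiffOn fun r hr ↦ hr, fun m hm ↦ ?_⟩
  obtain ⟨h1, h2, h3, h4⟩ := h m hm
  refine ⟨fun g ↦ (congrArg X.φ (Φ.symm_apply_apply _)).trans (h1 g), fun g g' ↦ ?_,
    fun g ↦ (congrArg θ (Φ.symm_apply_apply _)).trans (h3 g), fun r hr ↦ ?_⟩
  · change Φ (τ (g * g', m)) = Φ (X.mul (Φ.symm _) (Φ.symm _))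
    rw [Φ.symm_apply_apply, Φ.symm_apply_apply, h2]
  · change Φ (τ (θ (Φ.symm r), m)) = r
    rw [h4 _ hr, Φ.apply_symm_apply]

/-- An element of the band transported along a diffeomorphism of the manifold of arrows. -/
def LieGroupoidExtension.Band.transport {X : LieGroupoidExtension 𝒢 IR R} (b : X.Band IG G)
    (Φ : Diffeomorph IR IR' R R' ∞)
    (hsrc : Manifold.IsSubmersion IR' IM ∞ (fun r ↦ X.src (Φ.symm r)))
    (htgt : Manifold.IsSubmersion IR' IM ∞ (fun r ↦ X.tgt (Φ.symm r)))
    (hφ : Manifold.IsSubmersion IR' IΓ ∞ (fun r ↦ X.φ (Φ.symm r))) :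
    (X.transport Φ hsrc htgt hφ).Band IG G where
  base := b.base
  toFun g := Φ (b.toFun g)
  φ_toFun g := (congrArg X.φ (Φ.symm_apply_apply _)).trans (b.φ_toFun g)
  toFun_mul g g' := by
    change _ = Φ (X.mul (Φ.symm _) (Φ.symm _))
    rw [Φ.symm_apply_apply, Φ.symm_apply_apply, b.toFun_mul]
  contMDiff_toFun := Φ.contMDiff.comp b.contMDiff_toFun
  exists_inverse := by
    obtain ⟨θ, hθ, h1, h2⟩ := b.exists_inverse
    refine ⟨fun r ↦ θ (Φ.symm r), hθ.comp Φ.symm.contMDiff.contMDiffOn fun r hr ↦ hr,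
      fun g ↦ (congrArg θ (Φ.symm_apply_apply _)).trans (h1 g), fun r hr ↦ ?_⟩
    rw [h2 _ hr, Φ.apply_symm_apply]

end

/-- The principal bundle transported along a diffeomorphism of the total space. -/
def LiePrincipalBundle.transport (Q : LiePrincipalBundle IM M IH H IP P)
    (Ψ : Diffeomorph IP IP' P P' ∞) : LiePrincipalBundle IM M IH H IP' P' where
  proj p := Q.proj (Ψ.symm p)
  act p h := Ψ (Q.act (Ψ.symm p) h)
  proj_act p h := by simp only [Ψ.symm_apply_apply, Q.proj_act]
  act_one p := by simp only [Q.act_one, Ψ.apply_symm_apply]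
  act_mul p h h' := by simp only [Q.act_mul, Ψ.symm_apply_apply]
  contMDiff_proj := Q.contMDiff_proj.comp Ψ.symm.contMDiff
  contMDiff_act := Ψ.contMDiff.comp (Q.contMDiff_act.comp
    (Ψ.symm.contMDiff.prodMap contMDiff_id))
  locally_trivial m := by
    obtain ⟨e, hm, he, he', h⟩ := Q.locally_trivial m
    refine ⟨e.compHomeomorph Ψ.symm.toHomeomorph, hm, ?_, ?_, ?_⟩
    · exact he.comp Ψ.symm.contMDiff.contMDiffOn fun p hp ↦ hp
    · exact Ψ.contMDiff.comp_contMDiffOn he'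
    · intro p hp g
      change (e (Ψ.symm (Ψ _))).2 = _
      rw [Ψ.symm_apply_apply]
      exact h _ hp g

/-- The principal bundle over a Lie groupoid transported along diffeomorphisms. -/
def LiePrincipalBundleOver.transport {𝒜 : LieGroupoid IM M IR R}
    (Q : LiePrincipalBundleOver 𝒜 IH H IP P) (Φ : Diffeomorph IR IR' R R' ∞)
    (Ψ : Diffeomorph IP IP' P P' ∞)
    (hsrc : Manifold.IsSubmersion IR' IM ∞ (fun r ↦ 𝒜.src (Φ.symm r)))
    (htgt : Manifold.IsSubmersion IR' IM ∞ (fun r ↦ 𝒜.tgt (Φ.symm r))) :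
    LiePrincipalBundleOver (𝒜.transport Φ hsrc htgt) IH H IP' P' where
  toLiePrincipalBundle := Q.toLiePrincipalBundle.transport Ψ
  gact r p := Ψ (Q.gact (Φ.symm r) (Ψ.symm p))
  proj_gact r p h := (congrArg Q.proj (Ψ.symm_apply_apply _)).trans (Q.proj_gact _ _ h)
  unit_gact p := by
    change Ψ (Q.gact (Φ.symm (Φ (𝒜.unit (Q.proj (Ψ.symm p))))) (Ψ.symm p)) = p
    rw [Φ.symm_apply_apply, Q.unit_gact, Ψ.apply_symm_apply]
  mul_gact a b p h h' := by
    change Ψ (Q.gact (Φ.symm (Φ (𝒜.mul (Φ.symm a) (Φ.symm b)))) (Ψ.symm p)) = _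
    rw [Φ.symm_apply_apply, Q.mul_gact _ _ _ h h', Ψ.symm_apply_apply]
  gact_act r p g h := by
    change Ψ (Q.gact (Φ.symm r) (Ψ.symm (Ψ (Q.act (Ψ.symm p) g)))) =
      Ψ (Q.act (Ψ.symm (Ψ _)) g)
    rw [Ψ.symm_apply_apply, Ψ.symm_apply_apply, Q.gact_act _ _ _ h]
  contMDiffOn_gact := Ψ.contMDiff.comp_contMDiffOn (Q.contMDiffOn_gact.comp
    (Φ.symm.contMDiff.prodMap Ψ.symm.contMDiff).contMDiffOn fun _ hq ↦ hq)

variable (X : CrossedModuleExtension C 𝒢 IR R IP P) (Φ : Diffeomorph IR IR' R R' ∞)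
  (Ψ : Diffeomorph IP IP' P P' ∞)
  (hsrc : Manifold.IsSubmersion IR' IM ∞ (fun r ↦ X.ext.src (Φ.symm r)))
  (htgt : Manifold.IsSubmersion IR' IM ∞ (fun r ↦ X.ext.tgt (Φ.symm r)))
  (hφ : Manifold.IsSubmersion IR' IΓ ∞ (fun r ↦ X.ext.φ (Φ.symm r)))

/-- The `G → H`-extension transported along diffeomorphisms of the manifold of arrows and of the
principal bundle. -/
def CrossedModuleExtension.transport : CrossedModuleExtension C 𝒢 IR' R' IP' P' where
  ext := X.ext.transport Φ hsrc htgt hφ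
  isGroupExtension := X.ext.isGroupExtension_transport Φ hsrc htgt hφ X.isGroupExtension
  bundle := X.bundle.transport Φ Ψ hsrc htgt
  χ p := (X.χ (Ψ.symm p)).transport Φ hsrc htgt hφ
  base_χ p := X.base_χ _
  contMDiff_χ := Φ.contMDiff.comp (X.contMDiff_χ.comp (Ψ.symm.contMDiff.prodMap contMDiff_id))
  χ_equivariant r p h g hr := by
    change Φ ((X.χ (Ψ.symm (Ψ (X.bundle.act (Ψ.symm (Ψ (X.bundle.gact (Φ.symm r) (Ψ.symm p))))
      h)))).toFun g) = Φ (X.ext.mul (Φ.symm (Φ (X.ext.mul (Φ.symm r)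
        (Φ.symm (Φ ((X.χ (Ψ.symm p)).toFun (C.j h g))))))) (Φ.symm (Φ (X.ext.inv (Φ.symm r)))))
    rw [Ψ.symm_apply_apply, Ψ.symm_apply_apply, Φ.symm_apply_apply, Φ.symm_apply_apply,
      Φ.symm_apply_apply, X.χ_equivariant _ _ _ _ hr]
  act_ρ p g := by
    change Ψ (X.bundle.act (Ψ.symm p) (C.ρ g)) =
      Ψ (X.bundle.gact (Φ.symm (Φ ((X.χ (Ψ.symm p)).toFun g))) (Ψ.symm p))
    rw [Φ.symm_apply_apply, X.act_ρ]

/-- A `G → H`-extension is isomorphic to its transport along diffeomorphisms. -/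
def CrossedModuleExtension.transportIso : X.Iso (X.transport Φ Ψ hsrc htgt hφ) where
  Φ := Φ
  Ψ := Ψ
  φ_Φ r := congrArg X.ext.φ (Φ.symm_apply_apply r)
  Φ_mul a b _ := by
    change _ = Φ (X.ext.mul (Φ.symm (Φ a)) (Φ.symm (Φ b)))
    rw [Φ.symm_apply_apply, Φ.symm_apply_apply]
  proj_Ψ p := congrArg X.bundle.proj (Ψ.symm_apply_apply p)
  Ψ_equivariant r p h _ := by
    change _ = Ψ (X.bundle.act (Ψ.symm (Ψ (X.bundle.gact (Φ.symm (Φ r)) (Ψ.symm (Ψ p))))) h)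
    rw [Φ.symm_apply_apply, Ψ.symm_apply_apply, Ψ.symm_apply_apply]
  χ_Ψ p g := by
    change Φ ((X.χ (Ψ.symm (Ψ p))).toFun g) = _
    rw [Ψ.symm_apply_apply]

end Transport

/-! ### Principal bundles as smooth torsors -/

section PrincipalBundleTorsor

variable {EM HM EH HH EP HP : Type*} [NormedAddCommGroup EM]
  [NormedSpace ℝ EM] [TopologicalSpace HM] [NormedAddCommGroup EH] [NormedSpace ℝ EH]
  [TopologicalSpace HH] [NormedAddCommGroup EP] [NormedSpace ℝ EP] [TopologicalSpace HP]
  {IM : ModelWithCorners ℝ EM HM} {M : Type*} [TopologicalSpace M] [ChartedSpace HM M]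
  {IH : ModelWithCorners ℝ EH HH} {H : Type*} [TopologicalSpace H] [ChartedSpace HH H]
  {IP : ModelWithCorners ℝ EP HP} {P : Type*} [TopologicalSpace P] [ChartedSpace HP P]

/-- The trivialisation of a free smooth torsor that is given by a global section. -/
def IsSmoothTorsor.diffeomorphOfSection {π : P → M} {act : P → H → P} {div : P → P → H}
    (T : IsSmoothTorsor IH IP π act div) (hdiv : ∀ p h, div p (act p h) = h)
    (hπ : ContMDiff IP IM ∞ π) {s : M → P} (hs : ContMDiff IM IP ∞ s) (hs' : ∀ m, π (s m) = m) :
    Diffeomorph (IM.prod IH) IP (M × H) P ∞ where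
  toFun q := act (s q.1) q.2
  invFun p := (π p, div (s (π p)) p)
  left_inv q := by simp only [T.proj_act, hs', hdiv, Prod.mk.eta]
  right_inv p := T.act_div _ _ (hs' _)
  contMDiff_toFun := T.contMDiff_act.comp ((hs.comp contMDiff_fst).prodMk contMDiff_snd)
  contMDiff_invFun := by
    refine hπ.prodMk ?_
    rw [← contMDiffOn_univ]
    exact T.contMDiffOn_div.comp ((hs.comp hπ).prodMk contMDiff_id).contMDiffOn
      fun p _ ↦ hs' (π p)

variable [IsManifold IM ∞ M] [Group H] [LieGroup IH ∞ H] [IsManifold IP ∞ P]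

/-- The division map of a principal bundle is smooth. -/
theorem LiePrincipalBundle.exists_isSmoothTorsor (Q : LiePrincipalBundle IM M IH H IP P) :
    ∃ div : P → P → H, IsSmoothTorsor IH IP Q.proj Q.act div ∧
      ∀ p h, div p (Q.act p h) = h := by
  choose e he he₁ he₂ he₃ using Q.locally_trivial
  have hact : ∀ m p q, Q.proj p ∈ (e m).baseSet → Q.proj p = Q.proj q →
      Q.act p ((e m p).2⁻¹ * (e m q).2) = q := by
    intro m p q hp hpq
    have hps : p ∈ (e m).source := (e m).mem_source.2 hp
    have hqs : q ∈ (e m).source := (e m).mem_source.2 (hpq ▸ hp)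
    have has : Q.act p ((e m p).2⁻¹ * (e m q).2) ∈ (e m).source :=
      (e m).mem_source.2 (by rw [Q.proj_act]; exact hp)
    refine (e m).injOn has hqs (Prod.ext ?_ ?_)
    · exact ((e m).coe_fst has).trans ((Q.proj_act _ _).trans
        (hpq.trans ((e m).coe_fst hqs).symm))
    · exact (he₃ m p hps _).trans (mul_inv_cancel_left _ _)
  have hact' : ∀ m p h, Q.proj p ∈ (e m).baseSet → (e m p).2⁻¹ * (e m (Q.act p h)).2 = h := by
    intro m p h hp
    rw [he₃ m p ((e m).mem_source.2 hp), inv_mul_cancel_left]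
  let div : P → P → H := fun p q ↦ (e (Q.proj p) p).2⁻¹ * (e (Q.proj p) q).2
  -- The trivialisation chosen in `div` varies uncontrollably with `p`, but the action is free, so
  -- the value does not depend on it. Near a given pair one fixed trivialisation can therefore be
  -- used.
  have hdiv : ∀ m p q, Q.proj p ∈ (e m).baseSet → Q.proj p = Q.proj q →
      div p q = (e m p).2⁻¹ * (e m q).2 := by
    intro m p q hp hpq
    have h1 := hact' m p (div p q) hp
    rwa [hact (Q.proj p) p q (he _) hpq, eq_comm] at h1
  refine ⟨div, ⟨Q.contMDiff_act, ?_, Q.proj_act, fun p q hpq ↦ hact _ p q (he _) hpq⟩,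
    fun p h ↦ hact' _ p h (he _)⟩
  rintro ⟨p, q⟩ (hpq : Q.proj p = Q.proj q)
  let t := e (Q.proj p)
  have hp : p ∈ t.source := t.mem_source.2 (he _)
  have hq : q ∈ t.source := t.mem_source.2 (hpq ▸ he _)
  have hsnd : ∀ x ∈ t.source, ContMDiffAt IP IH ∞ (fun x ↦ (t x).2) x := fun x hx ↦
    contMDiffAt_snd.comp x ((he₁ _).contMDiffAt (t.open_source.mem_nhds hx))
  have h1 : ContMDiffAt (IP.prod IP) IH ∞ (fun x : P × P ↦ (t x.1).2⁻¹ * (t x.2).2) (p, q) :=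
    (ContMDiffAt.comp (g := fun x ↦ (t x).2) (p, q) (hsnd p hp) contMDiffAt_fst).inv.mul
      (ContMDiffAt.comp (g := fun x ↦ (t x).2) (p, q) (hsnd q hq) contMDiffAt_snd)
  refine h1.contMDiffWithinAt.congr_of_eventuallyEq ?_ (hdiv _ p q (he _) hpq)
  filter_upwards [self_mem_nhdsWithin, nhdsWithin_le_nhds
    (continuousAt_fst.eventually (t.open_source.mem_nhds hp))] with x hx hx'
  exact hdiv _ _ _ (t.mem_source.1 hx') hx

/-- A principal bundle has smooth local sections. -/
theorem LiePrincipalBundle.exists_local_section (Q : LiePrincipalBundle IM M IH H IP P) (m : M) :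
    ∃ W : Set M, IsOpen W ∧ m ∈ W ∧ ∃ σ : M → P, ContMDiffOn IM IP ∞ σ W ∧
      ∀ x ∈ W, Q.proj (σ x) = x := by
  obtain ⟨e, hm, -, he, -⟩ := Q.locally_trivial m
  have ht : ∀ x ∈ e.baseSet, (x, (1 : H)) ∈ e.target := fun x hx ↦ e.mem_target.2 hx
  refine ⟨e.baseSet, e.open_baseSet, hm, fun x ↦ e.toOpenPartialHomeomorph.symm (x, 1),
    he.comp (contMDiffOn_id.prodMk contMDiffOn_const) ht, fun x hx ↦ ?_⟩
  exact e.proj_symm_apply (ht x hx)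

end PrincipalBundleTorsor

/-! ### The arrows of an extension as a torsor under `G` -/

section ExtensionTorsor

variable {EM EΓ HΓ EG ER HR : Type*}
  [NormedAddCommGroup EM] [NormedSpace ℝ EM]
  [NormedAddCommGroup EΓ] [NormedSpace ℝ EΓ] [TopologicalSpace HΓ]
  [NormedAddCommGroup EG] [NormedSpace ℝ EG]
  [NormedAddCommGroup ER] [NormedSpace ℝ ER] [TopologicalSpace HR]
  {M : Type*} [TopologicalSpace M] [ChartedSpace EM M] [IsManifold 𝓘(ℝ, EM) ∞ M]
  {IΓ : ModelWithCorners ℝ EΓ HΓ} {Γ : Type*} [TopologicalSpace Γ] [ChartedSpace HΓ Γ]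
  [IsManifold IΓ ∞ Γ]
  {G : Type*} [TopologicalSpace G] [ChartedSpace EG G] [Group G] [LieGroup 𝓘(ℝ, EG) ∞ G]
  {IR : ModelWithCorners ℝ ER HR} {R : Type*} [TopologicalSpace R] [ChartedSpace HR R]
  [IsManifold IR ∞ R] {𝒢 : LieGroupoid 𝓘(ℝ, EM) M IΓ Γ}

theorem LieGroupoid.inv_unit (m : M) : 𝒢.inv (𝒢.unit m) = 𝒢.unit m := by
  have h1 := 𝒢.mul_inv (𝒢.unit m)
  have h2 := 𝒢.unit_mul (𝒢.inv (𝒢.unit m))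
  rw [𝒢.src_inv, 𝒢.tgt_unit] at h2
  rw [𝒢.src_unit] at h1
  exact h2.symm.trans h1

namespace LieGroupoidExtension

variable {X : LieGroupoidExtension 𝒢 IR R}

theorem src_of_φ_eq_unit {r : R} {m : M} (h : X.φ r = 𝒢.unit m) : X.src r = m := by
  rw [← X.src_φ, h, 𝒢.src_unit]

theorem tgt_of_φ_eq_unit {r : R} {m : M} (h : X.φ r = 𝒢.unit m) : X.tgt r = m := by
  rw [← X.tgt_φ, h, 𝒢.tgt_unit]

/-- For a smooth family of isomorphisms from `G` to the fibres of the kernel, the inverses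
also form a smooth family. -/
theorem exists_contMDiffOn_inverse [FiniteDimensional ℝ EM] [FiniteDimensional ℝ EG]
    (hX : X.IsGroupExtension 𝓘(ℝ, EG) G)
    {b : M → X.Band 𝓘(ℝ, EG) G} (hb : ∀ m, (b m).base = m)
    (hbs : ContMDiff (𝓘(ℝ, EM).prod 𝓘(ℝ, EG)) IR ∞ (fun q : M × G ↦ (b q.1).toFun q.2)) :
    ∃ κ : R → G, ContMDiffOn IR 𝓘(ℝ, EG) ∞ κ (X.kernelOver univ) ∧
      (∀ m g, κ ((b m).toFun g) = g) ∧
      ∀ r m, X.φ r = 𝒢.unit m → (b m).toFun (κ r) = r := by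
  have hbφ : ∀ m g, X.φ ((b m).toFun g) = 𝒢.unit m := fun m g ↦ by
    rw [(b m).φ_toFun, hb]
  choose ξ hξ hξ₁ hξ₂ using fun m ↦ (b m).exists_inverse
  simp only [hb] at hξ hξ₂
  -- Each `ξ m` is known to be smooth only on its own fibre of the kernel; joint smoothness in `m`
  -- is what has to be proved.
  refine ⟨fun r ↦ ξ (X.src r) r, ?_, fun m g ↦ ?_, fun r m h ↦ ?_⟩
  · rintro r₀ ⟨m₀, -, hr₀⟩
    have hsr₀ : X.src r₀ = m₀ := src_of_φ_eq_unit hr₀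
    obtain ⟨V, hV, hm₀, τ, θ, hτ, hθ, h⟩ := hX m₀
    -- A local trivialisation of the kernel turns the band elements into a family of bijections of
    -- `G`, with inverses `β`. Joint smoothness of `α` and smoothness of the single map `β (m₀, ·)`
    -- then give joint smoothness of `β` over `m₀`.
    let α : M × G → G := fun q ↦ θ ((b q.1).toFun q.2)
    let β : M × G → G := fun q ↦ ξ q.1 (τ (q.2, q.1))
    have hα : ContMDiffOn (𝓘(ℝ, EM).prod 𝓘(ℝ, EG)) 𝓘(ℝ, EG) ∞ α (V ×ˢ univ) :=
      hθ.comp hbs.contMDiffOn fun q hq ↦ ⟨q.1, hq.1, hbφ _ _⟩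
    have hVu : ∀ g : G, V ×ˢ univ ∈ 𝓝 (m₀, g) := fun g ↦
      (hV.prod isOpen_univ).mem_nhds ⟨hm₀, mem_univ g⟩
    have hβα : ∀ m ∈ V, ∀ g, β (m, α (m, g)) = g := by
      intro m hm g
      simp only [α, β]
      rw [(h m hm).2.2.2 _ (hbφ m g), hξ₁]
    have hαβ : ∀ m ∈ V, ∀ y, α (m, β (m, y)) = y := by
      intro m hm y
      simp only [α, β]
      rw [hξ₂ m _ ⟨m, rfl, (h m hm).1 y⟩, (h m hm).2.2.1]
    have hβ₀ : ContMDiff 𝓘(ℝ, EG) 𝓘(ℝ, EG) ∞ (fun y ↦ β (m₀, y)) := by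
      have h1 : ContMDiff 𝓘(ℝ, EG) IR ∞ (fun y ↦ τ (y, m₀)) := by
        rw [← contMDiffOn_univ]
        exact hτ.comp (contMDiff_id.prodMk contMDiff_const).contMDiffOn
          fun y _ ↦ ⟨mem_univ y, hm₀⟩
      rw [← contMDiffOn_univ]
      exact (hξ m₀).comp h1.contMDiffOn fun y _ ↦ ⟨m₀, rfl, (h m₀ hm₀).1 y⟩
    have hβ : ContMDiffAt (𝓘(ℝ, EM).prod 𝓘(ℝ, EG)) 𝓘(ℝ, EG) ∞ β (X.src r₀, θ r₀) := by
      rw [hsr₀]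
      exact contMDiffAt_parametrized_inverse (hα.contMDiffAt (hVu _)) hβ₀.contMDiffAt
        (hαβ m₀ hm₀) (Filter.eventually_of_mem (hV.mem_nhds hm₀) hβα)
    have hker : X.kernelOver V ∈ 𝓝[X.kernelOver univ] r₀ := by
      have h1 : ∀ᶠ r in 𝓝 r₀, X.src r ∈ V :=
        X.isSubmersion_src.contMDiff.continuous.continuousAt.eventually
          (hV.mem_nhds (hsr₀ ▸ hm₀))
      filter_upwards [nhdsWithin_le_nhds h1, self_mem_nhdsWithin] with r hr ⟨m, _, hm'⟩
      exact ⟨m, src_of_φ_eq_unit hm' ▸ hr, hm'⟩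
    have h1 : ContMDiffWithinAt IR (𝓘(ℝ, EM).prod 𝓘(ℝ, EG)) ∞ (fun r ↦ (X.src r, θ r))
        (X.kernelOver univ) r₀ :=
      X.isSubmersion_src.contMDiff.contMDiffAt.contMDiffWithinAt.prodMk
        ((hθ r₀ ⟨m₀, hm₀, hr₀⟩).mono_of_mem_nhdsWithin hker)
    have heq : ∀ r ∈ X.kernelOver V, ξ (X.src r) r = β (X.src r, θ r) := by
      rintro r ⟨m, hm, hr⟩
      simp only [β]
      rw [src_of_φ_eq_unit hr, (h m hm).2.2.2 r hr]
    exact (ContMDiffAt.comp_contMDiffWithinAt (g := β) r₀ hβ h1).congr_of_eventuallyEq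
      (Filter.eventually_of_mem hker heq) (heq r₀ ⟨m₀, hm₀, hr₀⟩)
  · dsimp only
    rw [src_of_φ_eq_unit (hbφ m g), hξ₁]
  · dsimp only
    rw [src_of_φ_eq_unit h, hξ₂ m _ ⟨m, rfl, h⟩]

/-- The left multiplication by the fibres of the kernel, identified with `G` by a smooth family of
isomorphisms, makes `φ` a smooth torsor. -/
theorem exists_isSmoothTorsor [FiniteDimensional ℝ EM] [FiniteDimensional ℝ EG]
    (hX : X.IsGroupExtension 𝓘(ℝ, EG) G)
    {b : M → X.Band 𝓘(ℝ, EG) G} (hb : ∀ m, (b m).base = m)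
    (hbs : ContMDiff (𝓘(ℝ, EM).prod 𝓘(ℝ, EG)) IR ∞ (fun q : M × G ↦ (b q.1).toFun q.2)) :
    ∃ div : R → R → G, IsSmoothTorsor 𝓘(ℝ, EG) IR X.φ
        (fun r g ↦ X.mul ((b (X.src r)).toFun g) r) div ∧
      ∀ r g, div r (X.mul ((b (X.src r)).toFun g) r) = g := by
  obtain ⟨κ, hκ, hκ₁, hκ₂⟩ := exists_contMDiffOn_inverse hX hb hbs
  have hbφ : ∀ m g, X.φ ((b m).toFun g) = 𝒢.unit m := fun m g ↦ by
    rw [(b m).φ_toFun, hb]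
  have hbt : ∀ m g, X.tgt ((b m).toFun g) = m := fun m g ↦ tgt_of_φ_eq_unit (hbφ m g)
  have htgt : ∀ r r', X.φ r = X.φ r' → X.tgt r = X.tgt r' := fun r r' h ↦ by
    rw [← X.tgt_φ, h, X.tgt_φ]
  have hcomp : ∀ r r', X.φ r = X.φ r' → X.tgt r' = X.src (X.inv r) := fun r r' h ↦ by
    rw [X.src_inv, htgt r r' h]
  have hdφ : ∀ r r', X.φ r = X.φ r' → X.φ (X.mul r' (X.inv r)) = 𝒢.unit (X.src r) := by
    intro r r' h
    rw [X.φ_mul _ _ (hcomp r r' h), ← h, ← X.φ_mul _ _ (hcomp r r rfl), X.mul_inv, X.φ_unit]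
  -- For `r`, `r'` over the same arrow, `r' r⁻¹` lies in the kernel over the source of `r`, and `κ`
  -- reads it as an element of `G`.
  refine ⟨fun r r' ↦ κ (X.mul r' (X.inv r)), ⟨?_, ?_, fun r g ↦ ?_, fun r r' h ↦ ?_⟩,
    fun r g ↦ ?_⟩
  · have h1 : ContMDiff (IR.prod 𝓘(ℝ, EG)) IR ∞
        (fun q : R × G ↦ (b (X.src q.1)).toFun q.2) :=
      hbs.comp ((X.isSubmersion_src.contMDiff.comp contMDiff_fst).prodMk contMDiff_snd)
    rw [← contMDiffOn_univ]
    exact X.contMDiffOn_mul.comp (h1.prodMk contMDiff_fst).contMDiffOn fun q _ ↦ hbt _ _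
  · have h1 : ContMDiffOn (IR.prod IR) IR ∞ (fun q : R × R ↦ X.mul q.2 (X.inv q.1))
        {q | X.φ q.1 = X.φ q.2} :=
      X.contMDiffOn_mul.comp (contMDiff_snd.prodMk
        (X.contMDiff_inv.comp contMDiff_fst)).contMDiffOn fun q hq ↦ hcomp _ _ hq
    exact hκ.comp h1 fun q hq ↦ ⟨_, mem_univ _, hdφ _ _ hq⟩
  · rw [X.φ_mul _ _ (hbt _ _), hbφ, ← X.src_φ, 𝒢.unit_mul]
  · rw [hκ₂ _ _ (hdφ r r' h), X.mul_assoc _ _ _ (hcomp r r' h) (X.tgt_inv r), X.inv_mul,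
      htgt r r' h, X.mul_unit]
  · dsimp only
    rw [X.mul_assoc _ _ _ (hbt _ _) (X.src_inv r).symm, X.mul_inv]
    have h1 := X.mul_unit ((b (X.src r)).toFun g)
    rw [hbt] at h1
    rw [h1, hκ₁]

end LieGroupoidExtension

variable {EH HH EP HP : Type*}
  [NormedAddCommGroup EH] [NormedSpace ℝ EH] [TopologicalSpace HH]
  [NormedAddCommGroup EP] [NormedSpace ℝ EP] [TopologicalSpace HP]
  {IH : ModelWithCorners ℝ EH HH} {H : Type*} [TopologicalSpace H] [ChartedSpace HH H] [Group H]
  [LieGroup IH ∞ H]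
  {IP : ModelWithCorners ℝ EP HP} {P : Type*} [TopologicalSpace P] [ChartedSpace HP P]
  [IsManifold IP ∞ P] {C : LieCrossedModule 𝓘(ℝ, EG) G IH H}

/-- Equivariance of `χ` at a unit arrow, where the action on `P` and the conjugation are both
trivial. -/
theorem CrossedModuleExtension.χ_act (X : CrossedModuleExtension C 𝒢 IR R IP P) (p : P) (h : H)
    (g : G) : (X.χ (X.bundle.act p h)).toFun g = (X.χ p).toFun (C.j h g) := by
  have h1 := X.χ_equivariant (X.ext.unit (X.bundle.proj p)) p h g (X.ext.tgt_unit _)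
  rw [X.bundle.unit_gact] at h1
  have hk : X.ext.φ ((X.χ p).toFun (C.j h g)) = 𝒢.unit (X.bundle.proj p) := by
    rw [(X.χ p).φ_toFun, X.base_χ]
  have h2 := X.ext.unit_mul ((X.χ p).toFun (C.j h g))
  have h3 := X.ext.mul_unit ((X.χ p).toFun (C.j h g))
  rw [LieGroupoidExtension.src_of_φ_eq_unit hk] at h2
  rw [LieGroupoidExtension.tgt_of_φ_eq_unit hk] at h3
  rw [h1, h2, LieGroupoid.inv_unit, h3]

end ExtensionTorsor

/-! ### Normalising sections over the Čech groupoid -/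

section CechSection

variable {EN : Type*} [NormedAddCommGroup EN] [NormedSpace ℝ EN]
  {N : Type*} [TopologicalSpace N] [ChartedSpace EN N] [IsManifold 𝓘(ℝ, EN) ∞ N]
  {ι : Type*} {U : ι → Opens N}
  {ER : Type*} [NormedAddCommGroup ER] [NormedSpace ℝ ER]
  {R : Type*} [TopologicalSpace R] [ChartedSpace ER R] [IsManifold 𝓘(ℝ, ER) ∞ R]

/-- A smooth section of an extension of the Čech groupoid can be modified to take the units of the
groupoid as values on the pieces `U i ∩ U i`. -/
theorem LieGroupoidExtension.exists_section_unit
    (X : LieGroupoidExtension (cechGroupoid 𝓘(ℝ, EN) U) 𝓘(ℝ, ER) R) {τ : CechArr U → R}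
    (hτ : ContMDiff 𝓘(ℝ, EN) 𝓘(ℝ, ER) ∞ τ) (hτ' : ∀ a, X.φ (τ a) = a) :
    ∃ τ' : CechArr U → R, ContMDiff 𝓘(ℝ, EN) 𝓘(ℝ, ER) ∞ τ' ∧ (∀ a, X.φ (τ' a) = a) ∧
      ∀ i x hi, τ' (cechArr U i i x hi hi) = X.unit (cechObj U i x hi) := by
  classical
  -- The diagonal pieces are open and closed in the disjoint union, so the section may be replaced
  -- there without affecting smoothness.
  refine ⟨fun a ↦ if a.1.1 = a.1.2 then X.unit ((cechGroupoid 𝓘(ℝ, EN) U).src a) else τ a,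
    contMDiff_of_sigmaOpens fun k ↦ ?_, ?_, fun i x hi ↦ if_pos rfl⟩
  · have hmk := contMDiff_sigmaOpens_mk (EN := EN) (V := fun p : ι × ι ↦ U p.1 ⊓ U p.2) k
    by_cases hk : k.1 = k.2
    · simp only [if_pos hk]
      exact X.contMDiff_unit.comp
        ((cechGroupoid 𝓘(ℝ, EN) U).isSubmersion_src.contMDiff.comp hmk)
    · simp only [if_neg hk]
      exact hτ.comp hmk
  · rintro ⟨⟨i, j⟩, x⟩
    dsimp only
    split_ifs with h
    · obtain rfl : i = j := h
      exact X.φ_unit _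
    · exact hτ' _

end CechSection

end

/-! ### Trivialising an extension of the Čech groupoid -/

theorem mainTheorem4
    {EN : Type*} [NormedAddCommGroup EN] [NormedSpace ℝ EN] [FiniteDimensional ℝ EN]
    {N : Type*} [TopologicalSpace N] [ChartedSpace EN N] [IsManifold 𝓘(ℝ, EN) ∞ N]
    [T2Space N] [SecondCountableTopology N]
    {EG : Type*} [NormedAddCommGroup EG] [NormedSpace ℝ EG] [FiniteDimensional ℝ EG]
    {G : Type*} [TopologicalSpace G] [ChartedSpace EG G] [Group G] [LieGroup 𝓘(ℝ, EG) ∞ G]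
    {EH : Type*} [NormedAddCommGroup EH] [NormedSpace ℝ EH] [FiniteDimensional ℝ EH]
    {H : Type*} [TopologicalSpace H] [ChartedSpace EH H] [Group H] [LieGroup 𝓘(ℝ, EH) ∞ H]
    (C : LieCrossedModule 𝓘(ℝ, EG) G 𝓘(ℝ, EH) H)
    {ι : Type*} (U : ι → Opens N) (hU : IsOpenCover U)
    (hcontr : ∀ i j, ((U i : Set N) ∩ U j).Nonempty → ContractibleSpace (U i ⊓ U j : Opens N))
    {ER : Type*} [NormedAddCommGroup ER] [NormedSpace ℝ ER] [FiniteDimensional ℝ ER]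
    {R : Type*} [TopologicalSpace R] [ChartedSpace ER R] [IsManifold 𝓘(ℝ, ER) ∞ R]
    {EP : Type*} [NormedAddCommGroup EP] [NormedSpace ℝ EP] [FiniteDimensional ℝ EP]
    {P : Type*} [TopologicalSpace P] [ChartedSpace EP P] [IsManifold 𝓘(ℝ, EP) ∞ P]
    (X : CrossedModuleExtension C (cechGroupoid 𝓘(ℝ, EN) U) 𝓘(ℝ, ER) R 𝓘(ℝ, EP) P) :
    ∃ A : CrossedModuleExtension C (cechGroupoid 𝓘(ℝ, EN) U)
        (𝓘(ℝ, EG).prod 𝓘(ℝ, EN)) (G × CechArr U) (𝓘(ℝ, EN).prod 𝓘(ℝ, EH)) (CechObj U × H),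
      A.IsAdapted ∧ Nonempty (X.Iso A) := by
  obtain ⟨divP, TP, hdivP⟩ := X.bundle.exists_isSmoothTorsor
  -- Contractibility of `U i` is the diagonal case `U i ⊓ U i` of the hypothesis.
  obtain ⟨σ, hσ, hσ'⟩ := TP.exists_section_sigmaOpens (fun i hi ↦ by
      have := hcontr i i (by rwa [inter_self])
      rwa [inf_idem] at this)
    X.bundle.exists_local_section
  have hb : ∀ m, (X.χ (σ m)).base = m := fun m ↦ (X.base_χ _).trans (hσ' m)
  obtain ⟨divR, TR, hdivR⟩ := LieGroupoidExtension.exists_isSmoothTorsor X.isGroupExtension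
    (b := fun m ↦ X.χ (σ m)) hb
    (X.contMDiff_χ.comp ((hσ.comp contMDiff_fst).prodMk contMDiff_snd))
  obtain ⟨τ₀, hτ₀, hτ₀'⟩ := TR.exists_section_sigmaOpens (fun k hk ↦ hcontr k.1 k.2 hk)
    (fun a ↦ by
      obtain ⟨r, rfl⟩ := X.ext.surjective_φ a
      exact X.ext.isSubmersion_φ.exists_local_section r)
  obtain ⟨τ, hτ, hτ', hτu⟩ := X.ext.exists_section_unit hτ₀ hτ₀'
  let Ψ := (TP.diffeomorphOfSection hdivP X.bundle.contMDiff_proj hσ hσ').symm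
  let Φ := ((Diffeomorph.prodComm 𝓘(ℝ, EG) 𝓘(ℝ, EN) G (CechArr U) ∞).trans
    (TR.diffeomorphOfSection hdivR X.ext.isSubmersion_φ.contMDiff hτ hτ')).symm
  have hΨ : ∀ q, Ψ.symm q = X.bundle.act (σ q.1) q.2 := fun q ↦ rfl
  have hΦ : ∀ q, Φ.symm q = X.ext.mul ((X.χ (σ (X.ext.src (τ q.2)))).toFun q.1) (τ q.2) :=
    fun q ↦ rfl
  -- Read through `Φ`, the map `φ` is the second projection, and source and target are that
  -- projection followed by those of the Čech groupoid; so all three are submersions on `G × CechArr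
  -- U`.
  have hφ : ∀ q, X.ext.φ (Φ.symm q) = q.2 := fun q ↦ (TR.proj_act _ _).trans (hτ' _)
  have hsrc : ∀ q, X.ext.src (Φ.symm q) = (cechGroupoid 𝓘(ℝ, EN) U).src q.2 := fun q ↦ by
    rw [← X.ext.src_φ, hφ]
  have htgt : ∀ q, X.ext.tgt (Φ.symm q) = (cechGroupoid 𝓘(ℝ, EN) U).tgt q.2 := fun q ↦ by
    rw [← X.ext.tgt_φ, hφ]
  have hτs : ∀ i j x hi hj, X.ext.src (τ (cechArr U i j x hi hj)) = cechObj U i x hi :=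
    fun i j x hi hj ↦ by rw [← X.ext.src_φ, hτ']; rfl
  have hχφ : ∀ m g, X.ext.φ ((X.χ (σ m)).toFun g) = (cechGroupoid 𝓘(ℝ, EN) U).unit m :=
    fun m g ↦ by rw [(X.χ (σ m)).φ_toFun, hb]
  -- The normalisation of `τ` enters here: on `U_ii` the factor `τ` is a unit and drops out, which
  -- gives the adapted forms of `χ` and of the product.
  have hΦu : ∀ i x hi g, Φ.symm (g, cechArr U i i x hi hi) =
      (X.χ (σ (cechObj U i x hi))).toFun g := by
    intro i x hi g
    have h1 := X.ext.mul_unit ((X.χ (σ (cechObj U i x hi))).toFun g)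
    rw [LieGroupoidExtension.tgt_of_φ_eq_unit (hχφ _ g)] at h1
    rw [hΦ, hτs, hτu, h1]
  refine ⟨X.transport Φ Ψ ?_ ?_ ?_, ⟨fun g a ↦ hφ (g, a), fun m h ↦ ?_, fun m h h' ↦ ?_,
    fun i x hi h g ↦ ?_, fun i j x hi hj g g' ↦ ?_⟩, ⟨X.transportIso Φ Ψ _ _ _⟩⟩
  · rw [funext hsrc]
    exact isSubmersion_snd_sigmaOpens G _ Prod.fst (fun _ ↦ rfl) (fun _ ↦ rfl)
  · rw [funext htgt]
    exact isSubmersion_snd_sigmaOpens G _ Prod.snd (fun _ ↦ rfl) (fun _ ↦ rfl)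
  · rw [funext hφ]
    exact isSubmersion_snd_sigmaOpens G (fun a ↦ a) (fun k ↦ k) (fun _ ↦ rfl) (fun _ ↦ rfl)
  · change X.bundle.proj (Ψ.symm (m, h)) = m
    rw [hΨ, X.bundle.proj_act, hσ']
  · change Ψ (X.bundle.act (Ψ.symm (m, h)) h') = (m, h * h')
    rw [hΨ, ← X.bundle.act_mul, ← hΨ (m, h * h'), Ψ.apply_symm_apply]
  · change Φ ((X.χ (Ψ.symm (cechObj U i x hi, h))).toFun g) = _
    rw [hΨ, X.χ_act, ← hΦu, Φ.apply_symm_apply]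
  · change Φ (X.ext.mul (Φ.symm _) (Φ.symm _)) = _
    have h1 : ∀ g, X.ext.tgt ((X.χ (σ (cechObj U i x hi))).toFun g) = cechObj U i x hi :=
      fun g ↦ LieGroupoidExtension.tgt_of_φ_eq_unit (hχφ _ g)
    have h2 : X.ext.src ((X.χ (σ (cechObj U i x hi))).toFun g') = cechObj U i x hi :=
      LieGroupoidExtension.src_of_φ_eq_unit (hχφ _ g')
    rw [hΦu, hΦ, hτs, ← X.ext.mul_assoc _ _ _ ((h1 g).trans h2.symm)
      ((h1 g').trans (hτs i j x hi hj).symm), ← (X.χ (σ (cechObj U i x hi))).toFun_mul]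
    have h3 := hΦ (g * g', cechArr U i j x hi hj)
    rw [hτs] at h3
    rw [← h3, Φ.apply_symm_apply]
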